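/- Partitions are identified with their Young diagrams (left-justified rows of boxes); $|\nu|$ is the number of boxes of $\nu$, $l(\nu)$ its number of positive parts, $dp(\nu)$ its number of different positive parts, and $\nu^1\cap\nu^2$ is the intersection of diagrams. For partitions $\mu\subseteq\lambda$ and $\nu$ let $c(\lambda;\mu,\nu)$ be the Littlewood–Richardson coefficient, i.e. the number of semistandard fillings of the skew diagram $\lambda/\mu$ with positive integers (rows weakly increasing from left to right, columns strictly increasing from top to bottom) that have content $\nu$ and whose reverse row word is a lattice word; let $[\lambda/\mu]=\sum_\nu c(\lambda;\mu,\nu)[\nu]$ be the skew character. Its components are the $[\nu]$ with $c(\lambda;\mu,\nu)\neq0$. Two partitions $\nu^1,\nu^2$ differ by one box if $|\nu^1\cap\nu^2|=|\nu^1|-1=|\nu^2|-1$. The skew diagram $\lambda/\mu$ is basic if $\mu_i<\lambda_i$ and $\mu_i\le\lambda_{i+1}$ for all $1\le i\le l(\lambda)$, and $\delta(\lambda/\mu)=\min(dp(\mu)+1,\,dp(\lambda))$. **Theorem.** Let $\lambda/\mu$ be a basic skew diagram with $\delta(\lambda/\mu)=n\ge2$. Then $[\lambda/\mu]$ has at least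 $g_n$ unordered pairs of components $[\nu^1],[\nu^2]$ such that $\nu^1,\nu^2$ differ by one box, where $g_n$ is the number of unordered pairs of partitions of $n$ that differ by one box. Furthermore, write $\lambda=(\lambda_1,\dots,\lambda_l)$ and $\mu=(\mu_1,\dots,\mu_m)$ with $\lambda_l,\mu_m\ge1$, and set $\mathcal A=(\lambda_1-2,\lambda_l-1)/(\mu_1-1)$ and $\mathcal B=(\lambda_2,\dots,\lambda_{l-1})/(\mu_2,\dots,\mu_m)$ (the empty skew diagram, whose character has exactly one component, if $l=2$). If $[\mathcal A]$ has $a$ components and $[\mathcal B]$ has $b$ components, then there are at least $\max(a,b)$ such unordered pairs of components of $[\lambda/\mu]$. -/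

import Mathlib

/-! Partitions are Mathlib's Young diagrams, with rows and columns numbered from `0`:
`nu.rowLen i` is the `(i + 1)`-st part of `nu`, `nu.colLen 0` is the length of `nu`,
`nu.rowLens` is the list of its (positive) parts, `nu.card` is the sum of its parts,
`⊓` is the intersection of diagrams and `≤` is containment. -/

namespace SkewChar

/-- The partition whose parts are the nonzero entries of the list `w`. For a weakly decreasing list
this is the diagram with row lengths `w`, see `ofParts_eq`. -/
def ofParts (w : List ℕ) : YoungDiagram :=
  YoungDiagram.ofRowLens ((w : Multiset ℕ).sort (· ≥ ·))
    (Multiset.pairwise_sort (w : Multiset ℕ) (· ≥ ·)).sortedGE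

theorem ofParts_eq (w : List ℕ) (hw : w.SortedGE) :
    ofParts w = YoungDiagram.ofRowLens w hw := by
  have h : (w : Multiset ℕ).sort (· ≥ ·) = w := by
    rw [Multiset.coe_sort]
    exact List.mergeSort_eq_self _ hw.pairwise
  simp only [ofParts, h]

/-- The boxes of the skew diagram `lam / mu`. -/
def skewCells (lam mu : YoungDiagram) : Finset (ℕ × ℕ) := lam.cells \ mu.cells

/-- The reverse row word of a filling `T` of `lam / mu`: the entries are read from right to left in
each row, the rows from top to bottom. -/
def reverseRowWord (lam mu : YoungDiagram) (T : ℕ → ℕ → ℕ) : List ℕ :=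
  (List.range (lam.colLen 0)).flatMap fun i =>
    ((List.range' (mu.rowLen i) (lam.rowLen i - mu.rowLen i)).reverse).map (T i)

/-- A word is a lattice word if every initial segment has, for each `i ≥ 1`, at least as many
entries `i` as entries `i + 1`. -/
def IsLatticeWord (w : List ℕ) : Prop :=
  ∀ i n : ℕ, 1 ≤ i → (w.take n).count (i + 1) ≤ (w.take n).count i

/-- Littlewood–Richardson tableaux of shape `lam / mu` and content `nu`: semistandard fillings of
the boxes by positive integers whose reverse row word is a lattice word. As a normalization,
`entry` is `0` outside the shape. -/
@[ext]
structure LRTableau (lam mu nu : YoungDiagram) where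
  entry : ℕ → ℕ → ℕ
  subset : mu ≤ lam
  zero_off : ∀ i j, (i, j) ∉ skewCells lam mu → entry i j = 0
  pos : ∀ i j, (i, j) ∈ skewCells lam mu → 0 < entry i j
  row_weak : ∀ i j₁ j₂, j₁ < j₂ → (i, j₁) ∈ skewCells lam mu → (i, j₂) ∈ skewCells lam mu →
    entry i j₁ ≤ entry i j₂
  col_strict : ∀ i₁ i₂ j, i₁ < i₂ → (i₁, j) ∈ skewCells lam mu → (i₂, j) ∈ skewCells lam mu →
    entry i₁ j < entry i₂ j
  content : ∀ k, ((skewCells lam mu).filter fun c => entry c.1 c.2 = k + 1).card = nu.rowLen k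
  lattice : IsLatticeWord (reverseRowWord lam mu entry)

theorem LRTableau.entry_le {lam mu nu : YoungDiagram} (T : LRTableau lam mu nu) (i j : ℕ) :
    T.entry i j ≤ nu.colLen 0 := by
  by_cases h : (i, j) ∈ skewCells lam mu
  · obtain ⟨k, hk⟩ := Nat.exists_eq_succ_of_ne_zero (T.pos i j h).ne'
    have hc : 0 < nu.rowLen k := by
      rw [← T.content k]
      exact Finset.card_pos.2 ⟨(i, j), by simp [h, hk]⟩
    rw [← YoungDiagram.mem_iff_lt_rowLen, YoungDiagram.mem_iff_lt_colLen] at hc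
    omega
  · simp [T.zero_off i j h]

instance (lam mu nu : YoungDiagram) : Finite (LRTableau lam mu nu) := by
  let F : LRTableau lam mu nu → (skewCells lam mu → Fin (nu.colLen 0 + 1)) :=
    fun T c => ⟨T.entry c.1.1 c.1.2, Nat.lt_succ_of_le (T.entry_le _ _)⟩
  refine Finite.of_injective F fun T S hTS => ?_
  ext i j
  by_cases h : (i, j) ∈ skewCells lam mu
  · have := congrFun hTS ⟨(i, j), h⟩
    simpa [F] using this
  · rw [T.zero_off i j h, S.zero_off i j h]

/-- The Littlewood–Richardson coefficient `c(lam; mu, nu)`. -/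
noncomputable def lrCoeff (lam mu nu : YoungDiagram) : ℕ := Nat.card (LRTableau lam mu nu)

/-- The partitions `nu` labelling the components `[nu]` of the skew character
`[lam / mu] = ∑ c(lam; mu, nu) [nu]`. -/
def components (lam mu : YoungDiagram) : Set YoungDiagram := {nu | lrCoeff lam mu nu ≠ 0}

/-- `|nu₁ ∩ nu₂| = |nu₁| - 1 = |nu₂| - 1`. -/
def DifferByOneBox (nu₁ nu₂ : YoungDiagram) : Prop :=
  (nu₁ ⊓ nu₂).card + 1 = nu₁.card ∧ (nu₁ ⊓ nu₂).card + 1 = nu₂.card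

/-- The unordered pairs of components of `[lam / mu]` that differ by one box. -/
def componentPairs (lam mu : YoungDiagram) : Set (Sym2 YoungDiagram) :=
  {p | ∃ nu₁ nu₂, p = s(nu₁, nu₂) ∧ nu₁ ∈ components lam mu ∧ nu₂ ∈ components lam mu ∧
    DifferByOneBox nu₁ nu₂}

/-- `g_n`, the number of unordered pairs of partitions of `n` that differ by one box. -/
noncomputable def g (n : ℕ) : ℕ∞ :=
  {p : Sym2 YoungDiagram | ∃ nu₁ nu₂, p = s(nu₁, nu₂) ∧ nu₁.card = n ∧ nu₂.card = n ∧
    DifferByOneBox nu₁ nu₂}.encard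

/-- The number of different (positive) parts of a partition. -/
def dp (lam : YoungDiagram) : ℕ := lam.rowLens.toFinset.card

/-- `lam / mu` is a basic skew diagram. -/
def IsBasic (lam mu : YoungDiagram) : Prop :=
  mu ≤ lam ∧ ∀ i < lam.colLen 0, mu.rowLen i < lam.rowLen i ∧ mu.rowLen i ≤ lam.rowLen (i + 1)

/-- The `δ` value of `lam / mu`: the largest `n` with `n ≤ dp mu + 1` and `n ≤ dp lam`. -/
def delta (lam mu : YoungDiagram) : ℕ := min (dp mu + 1) (dp lam)

end SkewChar

/-! ### Young diagrams by row and column lengths; sum and union of partitions. -/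

namespace SkewChar

open YoungDiagram

/-! Three constructions produce components. A Littlewood–Richardson tableau is determined by its row
contents, which are integer solutions of homogeneous linear conditions (`IsPattern`,
`mem_components_iff`). Solutions can be added, so sums of components are components of the sum of
the diagrams (`components_add`). Reflecting the shape in an antidiagonal while conjugating the
content (`HasPattern.antitranspose`) turns this into the same statement for unions of parts
(`components_union`). Finally, inserting an isolated box into the diagram allows any addable box to
be added to a component (`HasPattern.insert_box`).

Adding a fixed partition, or taking the union with one, respects intersections and shifts sizes, so
it preserves differing by one box. The first bound therefore follows from the stronger property
`Rich n`: a map of this kind sends every partition of `n` to a component (`Rich.g_le`). Inserting a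
row or a column into both diagrams keeps `n`, provided that the one inserted into `mu` is not the
longer one. Inserting an isolated box raises `n` by one without changing the map
(`Rich.insert_box`).

A basic diagram is a pair of lattice paths with common ends and no common step (`Bal`). The upper
path bounds `lam` and has at least `dp lam` outer corners; the lower path bounds `mu` and has at
least `dp mu + 1` inner corners. `Bal.rich` takes `n` up to the smaller corner count, by induction
on the length. By `Bal.classify`, a nonempty pair has an isolated box, or a row or column whose
removal destroys no corner, or one path has strictly more corners than the other and a removal costs
at most one corner of that path alone. The classification goes through the connected pieces of the
diagram.

For the second bound, `lam / mu` is written as the sum of `A` and `(2, 1) / (1)`, united with `B`.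
The small diagram has two components that differ by one box. Combining them with a component of `A`
and one of `B` gives a pair, and the intersection of the pair remembers both choices
(`max_encard_le_encard_componentPairs`). -/

theorem ext_rowLen {a b : YoungDiagram} (h : ∀ i, a.rowLen i = b.rowLen i) : a = b := by
  ext ⟨i, j⟩
  simp only [mem_cells, mem_iff_lt_rowLen, h]

theorem ext_colLen {a b : YoungDiagram} (h : ∀ i, a.colLen i = b.colLen i) : a = b := by
  ext ⟨i, j⟩
  simp only [mem_cells, mem_iff_lt_colLen, h]

theorem lt_rowLen_iff_lt_colLen (a : YoungDiagram) (i j : ℕ) : j < a.rowLen i ↔ i < a.colLen j := by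
  rw [← mem_iff_lt_rowLen, mem_iff_lt_colLen]

theorem rowLen_eq_zero_iff (a : YoungDiagram) (i : ℕ) : a.rowLen i = 0 ↔ a.colLen 0 ≤ i := by
  have := lt_rowLen_iff_lt_colLen a i 0
  omega

theorem le_iff_rowLen_le {a b : YoungDiagram} : a ≤ b ↔ ∀ i, a.rowLen i ≤ b.rowLen i := by
  constructor
  · intro h i
    by_contra! hc
    rw [← mem_iff_lt_rowLen] at hc
    have := h hc
    rw [mem_iff_lt_rowLen] at this
    omega
  · rintro h ⟨i, j⟩ hc
    have hc : (i, j) ∈ a := hc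
    rw [mem_iff_lt_rowLen] at *
    exact hc.trans_le (h i)

theorem le_iff_colLen_le {a b : YoungDiagram} : a ≤ b ↔ ∀ i, a.colLen i ≤ b.colLen i := by
  rw [← transpose_le_iff, le_iff_rowLen_le]
  simp

theorem rowLen_inf (a b : YoungDiagram) (i : ℕ) : (a ⊓ b).rowLen i = min (a.rowLen i) (b.rowLen i) := by
  apply eq_of_forall_lt_iff
  intro j
  rw [← mem_iff_lt_rowLen, mem_inf, mem_iff_lt_rowLen, mem_iff_lt_rowLen, lt_min_iff]

theorem colLen_inf (a b : YoungDiagram) (i : ℕ) : (a ⊓ b).colLen i = min (a.colLen i) (b.colLen i) := by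
  apply eq_of_forall_lt_iff
  intro j
  rw [← mem_iff_lt_colLen, mem_inf, mem_iff_lt_colLen, mem_iff_lt_colLen, lt_min_iff]

theorem card_eq_sum_rowLen (a : YoungDiagram) {R : ℕ} (hR : a.colLen 0 ≤ R) :
    a.card = ∑ i ∈ Finset.range R, a.rowLen i := by
  rw [YoungDiagram.card, Finset.card_eq_sum_card_fiberwise (f := Prod.fst) (t := Finset.range R)]
  · exact Finset.sum_congr rfl fun i _ => (a.rowLen_eq_card).symm
  · rintro ⟨i, j⟩ h
    rw [Finset.mem_coe, mem_cells] at h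
    have h' := a.up_left_mem le_rfl (Nat.zero_le j) h
    rw [mem_iff_lt_colLen] at h'
    simpa using h'.trans_le hR

theorem card_transpose (a : YoungDiagram) : a.transpose.card = a.card := by
  simp [YoungDiagram.card, transpose]

/-- The Young diagram whose first `N` rows have lengths `f 0, f 1, …`. -/
def ofFun (f : ℕ → ℕ) (hf : Antitone f) (N : ℕ) : YoungDiagram where
  cells := (Finset.range N ×ˢ Finset.range (f 0)).filter fun c => c.2 < f c.1
  isLowerSet := by
    rintro ⟨i2, j2⟩ ⟨i1, j1⟩ ⟨hi : i1 ≤ i2, hj : j1 ≤ j2⟩ h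
    simp only [Finset.coe_filter, Finset.mem_product, Finset.mem_range, Set.mem_ofPred_eq] at h ⊢
    have := hf hi
    omega

theorem rowLen_ofFun {f : ℕ → ℕ} (hf : Antitone f) {N : ℕ} (hN : f N = 0) (i : ℕ) :
    (ofFun f hf N).rowLen i = f i := by
  apply eq_of_forall_lt_iff
  intro j
  rw [← mem_iff_lt_rowLen, ← mem_cells]
  simp only [ofFun, Finset.mem_filter, Finset.mem_product, Finset.mem_range]
  have h0 := hf (Nat.zero_le i)
  constructor
  · exact fun h => h.2
  · intro h
    have hi : i < N := by
      by_contra! hc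
      have := hf hc
      omega
    omega

/-- The partition whose parts are the sums of corresponding parts. -/
def add (a b : YoungDiagram) : YoungDiagram :=
  ofFun (fun i => a.rowLen i + b.rowLen i)
    (fun i j h => add_le_add (a.rowLen_anti i j h) (b.rowLen_anti i j h)) (a.colLen 0 + b.colLen 0)

@[simp]
theorem rowLen_add (a b : YoungDiagram) (i : ℕ) : (add a b).rowLen i = a.rowLen i + b.rowLen i := by
  refine rowLen_ofFun _ ?_ i
  rw [(rowLen_eq_zero_iff a _).2 (by omega), (rowLen_eq_zero_iff b _).2 (by omega)]

/-- The partition whose parts are the parts of both partitions. -/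
def union (a b : YoungDiagram) : YoungDiagram := (add a.transpose b.transpose).transpose

@[simp]
theorem colLen_union (a b : YoungDiagram) (i : ℕ) :
    (union a b).colLen i = a.colLen i + b.colLen i := by
  simp [union]

theorem card_add (a b : YoungDiagram) : (add a b).card = a.card + b.card := by
  rw [card_eq_sum_rowLen a (R := a.colLen 0 + b.colLen 0 + (add a b).colLen 0) (by omega),
    card_eq_sum_rowLen b (R := a.colLen 0 + b.colLen 0 + (add a b).colLen 0) (by omega),
    card_eq_sum_rowLen (add a b) (R := a.colLen 0 + b.colLen 0 + (add a b).colLen 0) (by omega),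
    ← Finset.sum_add_distrib]
  simp

theorem card_union (a b : YoungDiagram) : (union a b).card = a.card + b.card := by
  rw [union, card_transpose, card_add, card_transpose, card_transpose]

theorem add_inf (a b c : YoungDiagram) : add (a ⊓ b) c = add a c ⊓ add b c := by
  apply ext_rowLen
  simp [rowLen_inf, min_add_add_right]

theorem union_inf (a b c : YoungDiagram) : union (a ⊓ b) c = union a c ⊓ union b c := by
  apply ext_colLen
  simp [colLen_inf, min_add_add_right]

theorem add_le_add' {a b c d : YoungDiagram} (h : a ≤ b) (h' : c ≤ d) : add a c ≤ add b d := by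
  rw [le_iff_rowLen_le] at *
  intro i
  simpa using Nat.add_le_add (h i) (h' i)

theorem union_le_union {a b c d : YoungDiagram} (h : a ≤ b) (h' : c ≤ d) : union a c ≤ union b d := by
  rw [le_iff_colLen_le] at *
  intro i
  simpa using Nat.add_le_add (h i) (h' i)

theorem add_right_cancel {a b c : YoungDiagram} (h : add a c = add b c) : a = b := by
  apply ext_rowLen
  intro i
  have := congrArg (fun x => x.rowLen i) h
  simpa using this

theorem union_right_cancel {a b c : YoungDiagram} (h : union a c = union b c) : a = b := by
  apply ext_colLen
  intro i
  have := congrArg (fun x => x.colLen i) h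
  simpa using this

theorem union_comm (a b : YoungDiagram) : union a b = union b a := by
  apply ext_colLen
  intro i
  simp [Nat.add_comm]

end SkewChar

/-! ### Chains of horizontal strips, read by columns. -/

namespace SkewChar

open Finset

/-- A predicate inherited from `i + 1` by `i` holds on an initial segment, so its count is a
threshold. Row and column lengths are exchanged through this fact. -/
theorem lt_card_filter_range {R : ℕ} {p : ℕ → Prop} [DecidablePred p]
    (h : ∀ i, i + 1 < R → p (i + 1) → p i) :
    ∀ i < R, (p i ↔ i < ((range R).filter p).card) := by
  induction R with
  | zero => intro i hi; omega
  | succ R ih =>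
    have ih' := ih fun i hi => h i (by omega)
    have hle : ((range R).filter p).card ≤ R := (card_filter_le _ _).trans (by simp)
    rw [range_add_one, filter_insert]
    split_ifs with hR
    · have hall : ∀ m i, i + m = R → p i := by
        intro m
        induction m with
        | zero => rintro i rfl; exact hR
        | succ m ihm => intro i hi; exact h i (by omega) (ihm (i + 1) (by omega))
      rw [card_insert_of_notMem (by simp), filter_true_of_mem, card_range]
      · intro i hi
        simp [hall (R - i) i (by omega), hi]
      · intro i hi
        exact hall (R - i) i (by have := mem_range.1 hi; omega)
    · intro i hi
      rcases Nat.lt_succ_iff_lt_or_eq.1 hi with h1 | rfl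
      · exact ih' i h1
      · constructor
        · intro h2; exact absurd h2 hR
        · intro h2; omega

/-- The boxes in the first `c` columns are counted by columns and by rows. -/
theorem sum_min_eq (R c : ℕ) (f : ℕ → ℕ) :
    ∑ l ∈ range c, ((range R).filter fun k => l < f k).card = ∑ k ∈ range R, min (f k) c := by
  simp only [card_filter]
  rw [sum_comm]
  refine sum_congr rfl fun k _ => ?_
  rw [← card_filter]
  have : (range c).filter (fun l => l < f k) = range (min (f k) c) := by
    ext l
    simp [and_comm]
  rw [this, card_range]

theorem sum_ite_telescope (a : ℕ → ℤ) (v : ℕ) {n : ℕ} (h : v ≤ n) :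
    ∑ k ∈ range n, (if k < v then 0 else a (k + 1) - a k) = a n - a v := by
  induction n, h using Nat.le_induction with
  | base => rw [sub_self]; exact sum_eq_zero fun k hk => by simp [mem_range.1 hk]
  | succ n hn ih => rw [sum_range_succ, ih, if_neg (by omega)]; ring

/-- A chain `M · 0 ⊆ M · 1 ⊆ …` of partitions with `R` rows and parts at most `X` in which consecutive
members differ by horizontal strips `S 0, S 1, …`, such that, for all `i` and `k`, the strip `S (k + 1)`
has at most as many boxes in its first `i + 1` rows as `S k` has in its first `i` rows. -/
structure IsChain (R X : ℕ) (M : ℕ → ℕ → ℕ) : Prop where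
  mono : ∀ i < R, ∀ k, M i k ≤ M i (k + 1)
  strip : ∀ i, i + 1 < R → ∀ k, M (i + 1) (k + 1) ≤ M i k
  le : ∀ i < R, ∀ k, M i k ≤ X
  lattice : ∀ i < R, ∀ k, ∑ r ∈ range (i + 1), M r (k + 2) + ∑ r ∈ range i, M r k ≤
    ∑ r ∈ range (i + 1), M r (k + 1) + ∑ r ∈ range i, M r (k + 1)

namespace IsChain

/-- The number of boxes in the columns `j, j + 1, …` of the `k`-th member of a chain. -/
def area (R : ℕ) (M : ℕ → ℕ → ℕ) (j k : ℕ) : ℕ := ∑ i ∈ range R, (M i k - j)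

/-- The length of column `j` of the `k`-th member of a chain. -/
def height (R : ℕ) (M : ℕ → ℕ → ℕ) (j k : ℕ) : ℕ := ((range R).filter fun i => j < M i k).card

variable {R X : ℕ} {M : ℕ → ℕ → ℕ}

theorem area_eq (R : ℕ) (M : ℕ → ℕ → ℕ) (j k : ℕ) :
    area R M j k = area R M (j + 1) k + height R M j k := by
  rw [area, area, height, card_filter, ← sum_add_distrib]
  refine sum_congr rfl fun i _ => ?_
  split_ifs <;> omega

theorem area_mono (h : IsChain R X M) (j k : ℕ) : area R M j k ≤ area R M j (k + 1) :=
  sum_le_sum fun i hi => Nat.sub_le_sub_right (h.mono i (mem_range.1 hi) k) j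

theorem height_mono (h : IsChain R X M) (j k : ℕ) : height R M j k ≤ height R M j (k + 1) := by
  refine card_le_card fun i hi => ?_
  simp only [mem_filter, mem_range] at hi ⊢
  exact ⟨hi.1, hi.2.trans_le (h.mono i hi.1 k)⟩

theorem height_succ_le (R : ℕ) (M : ℕ → ℕ → ℕ) (j k : ℕ) : height R M (j + 1) k ≤ height R M j k := by
  refine card_le_card fun i hi => ?_
  simp only [mem_filter, mem_range] at hi ⊢
  omega

theorem row_anti (h : IsChain R X M) (i k : ℕ) (hi : i + 1 < R) : M (i + 1) k ≤ M i k :=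
  (h.mono (i + 1) hi k).trans (h.strip i hi k)

theorem lt_height_iff (h : IsChain R X M) (j k : ℕ) :
    ∀ i < R, (j < M i k ↔ i < height R M j k) :=
  lt_card_filter_range fun i hi hj => hj.trans_le (h.row_anti i k hi)

theorem height_le (R : ℕ) (M : ℕ → ℕ → ℕ) (j k : ℕ) : height R M j k ≤ R :=
  (card_filter_le _ _).trans (by simp)

/-- A horizontal strip has at most one box in each column. -/
theorem height_strip (h : IsChain R X M) (j k : ℕ) : height R M j (k + 1) ≤ height R M j k + 1 := by
  by_contra! hc
  have h1 := height_le R M j (k + 1)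
  have h2 := (h.lt_height_iff j (k + 1) (height R M j k + 1) (by omega)).2 hc
  have h3 := (h.lt_height_iff j k (height R M j k) (by omega)).1
    (h2.trans_le (h.strip _ (by omega) k))
  omega

/-- The column version of the lattice condition. -/
theorem area_concave (h : IsChain R X M) (j k : ℕ) :
    area R M j (k + 2) + area R M j k ≤ 2 * area R M j (k + 1) := by
  -- Row `i` is the first one not extending past column `j` at stage `k + 1`. By the strip condition
  -- all later rows stay out of the columns from `j` on even at stage `k + 2`.
  set i := height R M j (k + 1) with hi
  have hiR : i ≤ R := height_le _ _ _ _
  have hth := h.lt_height_iff j (k + 1)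
  rw [← hi] at hth
  have hz : ∀ r, i + 1 ≤ r → r < R → M r (k + 2) ≤ j := by
    intro r hr hrR
    obtain ⟨r', rfl⟩ : ∃ r', r = r' + 1 := ⟨r - 1, by omega⟩
    have : M (r' + 1) (k + 2) ≤ M r' (k + 1) := h.strip r' hrR (k + 1)
    have := hth r' (by omega)
    omega
  -- rows below row `i` contribute nothing
  have key : ∀ n ≤ R, i + 1 ≤ n → ∀ F : ℕ → ℕ, (∀ r, i + 1 ≤ r → r < R → F r = 0) →
      ∑ r ∈ range n, F r = ∑ r ∈ range (i + 1), F r := by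
    intro n hn hin F hF
    induction n, hin using Nat.le_induction with
    | base => rfl
    | succ n hin ih => rw [sum_range_succ, ih (by omega), hF n hin (by omega), add_zero]
  have exact1 : ∀ n ≤ i, ∀ F : ℕ → ℕ, (∀ r < n, j ≤ F r) →
      ∑ r ∈ range n, (F r - j) + n * j = ∑ r ∈ range n, F r := by
    intro n hn F hF
    induction n with
    | zero => simp
    | succ n ih =>
      rw [sum_range_succ, sum_range_succ, ← ih (by omega) fun r hr => hF r (by omega)]
      have := hF n (by omega)
      rw [Nat.succ_mul]
      omega
  have hmk : ∀ r < R, M r k ≤ M r (k + 1) := fun r hr => h.mono r hr k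
  have hmk' : ∀ r < R, M r (k + 1) ≤ M r (k + 2) := fun r hr => h.mono r hr (k + 1)
  have hanti : ∀ r s, r ≤ s → s < R → M s k ≤ M r k := by
    intro r s hrs
    induction s, hrs using Nat.le_induction with
    | base => intro _; exact le_rfl
    | succ s hs ih => intro hsR; exact (h.row_anti s k hsR).trans (ih (by omega))
  unfold area
  -- In this case every new box of stage `k + 1` in the rows above row `i` lies in a column `≥ j`,
  -- so cutting off the columns before `j` loses none of them. The lattice condition at row `i` then
  -- suffices (at row `i - 1` if `i = R`).
  by_cases hA : ∀ r < i, j ≤ M r k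
  · have e0 := exact1 i le_rfl (fun r => M r k) hA
    have e1 := exact1 i le_rfl (fun r => M r (k + 1)) fun r hr => (hA r hr).trans (hmk r (by omega))
    have e2 := exact1 i le_rfl (fun r => M r (k + 2)) fun r hr =>
      ((hA r hr).trans (hmk r (by omega))).trans (hmk' r (by omega))
    rcases hiR.eq_or_lt with hR | hR
    · rw [← hR]
      have hl : ∑ r ∈ range i, M r (k + 2) + ∑ r ∈ range i, M r k ≤
          ∑ r ∈ range i, M r (k + 1) + ∑ r ∈ range i, M r (k + 1) := by
        rcases Nat.eq_zero_or_pos i with h0 | h0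
        · simp [h0]
        · have := h.lattice (i - 1) (by omega) k
          rw [Nat.sub_add_cancel h0] at this
          obtain ⟨i', hi'⟩ : ∃ i', i = i' + 1 := ⟨i - 1, by omega⟩
          rw [hi'] at this ⊢
          simp only [Nat.add_sub_cancel] at this
          rw [sum_range_succ (fun r => M r k), sum_range_succ (fun r => M r (k + 1))]
          rw [sum_range_succ (fun r => M r (k + 1))] at this
          have := hmk i' (by omega)
          omega
      omega
    · rw [key R le_rfl hR (fun r => M r (k + 2) - j) fun r h1 h2 => by have := hz r h1 h2; omega,
        key R le_rfl hR (fun r => M r k - j) fun r h1 h2 => by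
          have := hz r h1 h2; have := hmk r h2; have := hmk' r h2; omega,
        key R le_rfl hR (fun r => M r (k + 1) - j) fun r h1 h2 => by
          have := hz r h1 h2; have := hmk' r h2; omega]
      have hl := h.lattice i hR k
      rw [sum_range_succ, sum_range_succ] at hl
      rw [sum_range_succ, sum_range_succ, sum_range_succ]
      have := hth i hR
      have := hmk i hR
      have := hmk' i hR
      omega
  · push Not at hA
    obtain ⟨r, hr, hrj⟩ := hA
    -- By the strip condition, only the last row above row `i` can be shorter than `j` at stage `k`.
    -- The strip condition also bounds what row `i` gains in the columns from `j` on at stage `k +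
    -- 2` by what row `r` gained there at stage `k + 1`; the rows above are covered by the lattice
    -- condition at `r`.
    have hri : r + 1 = i := by
      by_contra hne
      have := h.strip r (by omega) k
      have := hth (r + 1) (by omega)
      omega
    have hA' : ∀ s < r, j ≤ M s k := by
      intro s hs
      have := h.strip s (by omega) k
      have := hth (s + 1) (by omega)
      omega
    have e0 := exact1 r (by omega) (fun r => M r k) hA'
    have e1 := exact1 r (by omega) (fun r => M r (k + 1)) fun s hs =>
      (hA' s hs).trans (hmk s (by omega))
    have e2 := exact1 r (by omega) (fun r => M r (k + 2)) fun s hs =>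
      ((hA' s hs).trans (hmk s (by omega))).trans (hmk' s (by omega))
    have hl := h.lattice r (by omega) k
    rw [sum_range_succ, sum_range_succ] at hl
    have a1 := hth r (by omega)
    have a2 := hmk r (by omega)
    have a3 := hmk' r (by omega)
    rcases hiR.eq_or_lt with hR | hR
    · rw [← hR, ← hri]
      rw [sum_range_succ, sum_range_succ, sum_range_succ]
      omega
    · rw [key R le_rfl hR (fun r => M r (k + 2) - j) fun r h1 h2 => by have := hz r h1 h2; omega,
        key R le_rfl hR (fun r => M r k - j) fun r h1 h2 => by
          have := hz r h1 h2; have := hmk r h2; have := hmk' r h2; omega,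
        key R le_rfl hR (fun r => M r (k + 1) - j) fun r h1 h2 => by
          have := hz r h1 h2; have := hmk' r h2; omega]
      rw [← hri] at hR hth ⊢
      rw [sum_range_succ, sum_range_succ, sum_range_succ, sum_range_succ, sum_range_succ,
        sum_range_succ]
      have := hth (r + 1) hR
      have := hmk (r + 1) hR
      have : M (r + 1) (k + 2) ≤ M r (k + 1) := h.strip r hR (k + 1)
      omega

end IsChain

end SkewChar

/-! ### Patterns of row contents and the antidiagonal reflection. -/

namespace SkewChar

open Finset

/-- The row content description of a Littlewood–Richardson tableau with `R` rows:
`t i k` is the number of entries `k + 1` in the rows `0, …, i - 1`. -/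
structure IsPattern (R : ℕ) (lam mu nu : ℕ → ℕ) (t : ℕ → ℕ → ℕ) : Prop where
  zero : ∀ k, t 0 k = 0
  mono : ∀ i < R, ∀ k, t i k ≤ t (i + 1) k
  inter : ∀ i < R, ∀ k, t (i + 1) (k + 1) ≤ t i k
  row : ∀ i < R, mu i + ∑ l ∈ range (i + 1), t (i + 1) l = lam i + ∑ l ∈ range (i + 1), t i l
  ss : ∀ i, i + 1 < R → ∀ k,
    mu (i + 1) + ∑ l ∈ range (k + 1), t (i + 2) l + ∑ l ∈ range k, t i l ≤
      mu i + ∑ l ∈ range k, t (i + 1) l + ∑ l ∈ range (k + 1), t (i + 1) l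
  final : ∀ k, t R k = nu k

/-- There is a Littlewood–Richardson tableau with `R` rows of shape `lam / mu` and content `nu`. -/
def HasPattern (R : ℕ) (lam mu nu : ℕ → ℕ) : Prop := ∃ t, IsPattern R lam mu nu t

/-- The number of the first `R` parts that are greater than `j`. -/
def conj (R : ℕ) (f : ℕ → ℕ) (j : ℕ) : ℕ := ((range R).filter fun i => j < f i).card

theorem conj_le (R : ℕ) (f : ℕ → ℕ) (j : ℕ) : conj R f j ≤ R :=
  (card_filter_le _ _).trans (by simp)

theorem conj_congr {R : ℕ} {f g : ℕ → ℕ} (h : ∀ i < R, f i = g i) (j : ℕ) :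
    conj R f j = conj R g j := by
  unfold conj
  congr 1
  refine filter_congr fun i hi => ?_
  rw [h i (mem_range.1 hi)]

theorem HasPattern.congr {R : ℕ} {lam mu nu lam' mu' nu' : ℕ → ℕ} (h : HasPattern R lam mu nu)
    (hl : ∀ i < R, lam i = lam' i) (hm : ∀ i < R, mu i = mu' i) (hn : ∀ i, nu i = nu' i) :
    HasPattern R lam' mu' nu' := by
  obtain ⟨t, ht⟩ := h
  refine ⟨t, ht.zero, ht.mono, ht.inter, fun i hi => ?_, fun i hi k => ?_, fun k => ?_⟩
  · rw [← hl i hi, ← hm i hi]; exact ht.row i hi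
  · rw [← hm (i + 1) hi, ← hm i (by omega)]; exact ht.ss i hi k
  · rw [← hn]; exact ht.final k

/-- All conditions on a pattern are linear and homogeneous in the shape, the content and the pattern
together. -/
theorem HasPattern.add {R : ℕ} {lam mu nu lam' mu' nu' : ℕ → ℕ} (h : HasPattern R lam mu nu)
    (h' : HasPattern R lam' mu' nu') :
    HasPattern R (fun i => lam i + lam' i) (fun i => mu i + mu' i) (fun i => nu i + nu' i) := by
  obtain ⟨t, ht⟩ := h
  obtain ⟨t', ht'⟩ := h'
  refine ⟨fun i k => t i k + t' i k, fun k => ?_, fun i hi k => ?_, fun i hi k => ?_, fun i hi => ?_,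
    fun i hi k => ?_, fun k => ?_⟩
  · simp [ht.zero, ht'.zero]
  · exact Nat.add_le_add (ht.mono i hi k) (ht'.mono i hi k)
  · exact Nat.add_le_add (ht.inter i hi k) (ht'.inter i hi k)
  · have := ht.row i hi
    have := ht'.row i hi
    simp only [sum_add_distrib]
    omega
  · have := ht.ss i hi k
    have := ht'.ss i hi k
    simp only [sum_add_distrib]
    omega
  · simp [ht.final, ht'.final]

namespace IsPattern

variable {R : ℕ} {lam mu nu : ℕ → ℕ} {t : ℕ → ℕ → ℕ}

/-- The chain of shapes of a pattern: the length of row `i` of the subdiagram of the boxes that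
belong to `mu` or have an entry at most `k`. -/
def shape (mu : ℕ → ℕ) (t : ℕ → ℕ → ℕ) (i k : ℕ) : ℕ := mu i + ∑ l ∈ range k, (t (i + 1) l - t i l)

theorem eq_zero_of_le (h : IsPattern R lam mu nu t) {i : ℕ} (hi : i ≤ R) :
    ∀ l, i ≤ l → t i l = 0 := by
  induction i with
  | zero => intro l _; exact h.zero l
  | succ i ih =>
    intro l hl
    obtain ⟨l', rfl⟩ : ∃ l', l = l' + 1 := ⟨l - 1, by omega⟩
    have := h.inter i (by omega) l'
    rw [ih (by omega) l' (by omega)] at this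
    omega

theorem shape_add (h : IsPattern R lam mu nu t) {i : ℕ} (hi : i < R) (k : ℕ) :
    shape mu t i k + ∑ l ∈ range k, t i l = mu i + ∑ l ∈ range k, t (i + 1) l := by
  rw [shape, add_assoc, ← sum_add_distrib]
  congr 1
  exact sum_congr rfl fun l _ => Nat.sub_add_cancel (h.mono i hi l)

theorem shape_succ (mu : ℕ → ℕ) (t : ℕ → ℕ → ℕ) (i k : ℕ) :
    shape mu t i (k + 1) = shape mu t i k + (t (i + 1) k - t i k) := by
  rw [shape, shape, sum_range_succ, add_assoc]

theorem shape_zero (mu : ℕ → ℕ) (t : ℕ → ℕ → ℕ) (i : ℕ) : shape mu t i 0 = mu i := by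
  simp [shape]

theorem shape_mono (mu : ℕ → ℕ) (t : ℕ → ℕ → ℕ) (i : ℕ) : Monotone (shape mu t i) :=
  monotone_nat_of_le_succ fun k => by rw [shape_succ]; omega

theorem shape_of_lt (h : IsPattern R lam mu nu t) {i : ℕ} (hi : i < R) {k : ℕ} (hk : i < k) :
    shape mu t i k = lam i := by
  induction k, hk using Nat.le_induction with
  | base =>
    have h1 := h.shape_add hi (i + 1)
    have h2 := h.row i hi
    rw [Nat.succ_eq_add_one]
    omega
  | succ k hk ih =>
    rw [shape_succ, ih, h.eq_zero_of_le (by omega : i + 1 ≤ R) k hk]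
    omega

theorem shape_le (h : IsPattern R lam mu nu t) {i : ℕ} (hi : i < R) (k : ℕ) :
    shape mu t i k ≤ lam i := by
  rw [← h.shape_of_lt hi (k := max k (i + 1)) (by omega)]
  exact shape_mono mu t i (by omega)

theorem shape_strip (h : IsPattern R lam mu nu t) {i : ℕ} (hi : i + 1 < R) (k : ℕ) :
    shape mu t (i + 1) (k + 1) ≤ shape mu t i k := by
  have h1 := h.shape_add hi (k + 1)
  have h2 := h.shape_add (by omega : i < R) k
  have h3 := h.ss i hi k
  simp only [Nat.add_assoc, Nat.reduceAdd] at h1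
  omega

theorem sum_shape_succ (h : IsPattern R lam mu nu t) {n : ℕ} (hn : n ≤ R) (k : ℕ) :
    ∑ r ∈ range n, shape mu t r (k + 1) = ∑ r ∈ range n, shape mu t r k + t n k := by
  induction n with
  | zero => simp [h.zero]
  | succ n ih =>
    rw [sum_range_succ, sum_range_succ, ih (by omega), shape_succ]
    have := h.mono n (by omega) k
    omega

theorem isChain (h : IsPattern R lam mu nu t) {X : ℕ} (hX : ∀ i < R, lam i ≤ X) :
    IsChain R X (shape mu t) where
  mono i _ k := shape_mono mu t i (Nat.le_succ k)
  strip i hi k := h.shape_strip hi k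
  le i hi k := (h.shape_le hi k).trans (hX i hi)
  lattice i hi k := by
    have h1 := h.sum_shape_succ (by omega : i + 1 ≤ R) (k + 1)
    have h2 := h.sum_shape_succ hi.le k
    have h3 := h.inter i hi k
    simp only [Nat.add_assoc, Nat.reduceAdd] at h1
    omega

end IsPattern

namespace IsChain

variable {R X : ℕ} {M : ℕ → ℕ → ℕ}

/-- The number of entries `k + 1` in the columns `j, j + 1, …`. -/
def content (R : ℕ) (M : ℕ → ℕ → ℕ) (j k : ℕ) : ℕ := area R M j (k + 1) - area R M j k

theorem area_succ (h : IsChain R X M) (j k : ℕ) :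
    area R M j (k + 1) = area R M j k + content R M j k := by
  rw [content, Nat.add_sub_cancel' (h.area_mono j k)]

/-- Column `j` contributes to the letter `k + 1` exactly its growth in height between the stages `k`
and `k + 1`. -/
theorem content_add_height (h : IsChain R X M) (j k : ℕ) :
    content R M j k + height R M j k = content R M (j + 1) k + height R M j (k + 1) := by
  have h1 := h.area_succ j k
  have h2 := h.area_succ (j + 1) k
  have h3 := area_eq R M j k
  have h4 := area_eq R M j (k + 1)
  omega

theorem content_succ_le (h : IsChain R X M) (j k : ℕ) :
    content R M (j + 1) k ≤ content R M j k := by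
  have h1 := h.content_add_height j k
  have h2 := h.height_mono j k
  omega

theorem content_le_succ (h : IsChain R X M) (j k : ℕ) :
    content R M j k ≤ content R M (j + 1) k + 1 := by
  have h1 := h.content_add_height j k
  have h2 := h.height_strip j k
  omega

theorem content_anti (h : IsChain R X M) (j k : ℕ) :
    content R M j (k + 1) ≤ content R M j k := by
  have h1 := h.area_succ j k
  have h2 := h.area_succ j (k + 1)
  have h3 := h.area_concave j k
  simp only [Nat.add_assoc, Nat.reduceAdd] at h2
  omega

theorem content_of_ge (h : IsChain R X M) (k : ℕ) : content R M X k = 0 := by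
  have : ∀ k, area R M X k = 0 := fun k => by
    refine sum_eq_zero fun i hi => ?_
    have := h.le i (mem_range.1 hi) k
    omega
  simp [content, this]

theorem content_le (h : IsChain R X M) (m : ℕ) : ∀ j, j + m = X → ∀ k, content R M j k ≤ m := by
  induction m with
  | zero => rintro j rfl k; exact (h.content_of_ge k).le
  | succ m ih =>
    intro j hj k
    have h1 := ih (j + 1) (by omega) k
    have h2 := h.content_le_succ j k
    omega

theorem sum_content (h : IsChain R X M) (j n : ℕ) :
    area R M j 0 + ∑ k ∈ range n, content R M j k = area R M j n := by
  induction n with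
  | zero => simp
  | succ n ih => rw [sum_range_succ, h.area_succ, ← ih, add_assoc]

/-- The column version of semistandardness. -/
theorem sum_min_content_le (h : IsChain R X M) (j c : ℕ) :
    ∑ k ∈ range R, min (content R M j k) (c + 1) + ∑ k ∈ range R, min (content R M (j + 2) k) c
        + height R M (j + 1) R ≤
      ∑ k ∈ range R, min (content R M (j + 1) k) c
        + ∑ k ∈ range R, min (content R M (j + 1) k) (c + 1) + height R M j R := by
  -- The letters below `v` occur more than `c` times in the columns from `j + 1` on; for them both
  -- sums of minima contribute `2 * c + 1`. For the other letters the excess is bounded by an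
  -- increment of the height difference of columns `j` and `j + 1`, and these increments telescope.
  set v := conj R (content R M (j + 1)) c with hv
  have hvR : v ≤ R := conj_le _ _ _
  have hth : ∀ k < R, (c < content R M (j + 1) k ↔ k < v) :=
    lt_card_filter_range fun k _ hk => hk.trans_le (h.content_anti (j + 1) k)
  have key : ∀ k ∈ range R,
      ((min (content R M j k) (c + 1) + min (content R M (j + 2) k) c : ℕ) : ℤ) -
        ((min (content R M (j + 1) k) c + min (content R M (j + 1) k) (c + 1) : ℕ) : ℤ) ≤
      if k < v then 0 else ((height R M j (k + 1) : ℤ) - height R M (j + 1) (k + 1)) -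
        ((height R M j k : ℤ) - height R M (j + 1) k) := by
    intro k hk
    have h1 := hth k (mem_range.1 hk)
    have h2 := h.content_add_height j k
    have h3 : content R M (j + 1) k + height R M (j + 1) k =
      content R M (j + 2) k + height R M (j + 1) (k + 1) := h.content_add_height (j + 1) k
    split_ifs <;> omega
  have hsum := sum_le_sum key
  rw [sum_ite_telescope (fun k => (height R M j k : ℤ) - height R M (j + 1) k) v hvR,
    sum_sub_distrib, ← Nat.cast_sum, ← Nat.cast_sum, sum_add_distrib, sum_add_distrib] at hsum
  have := height_succ_le R M j v
  omega

end IsChain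

/-- Littlewood–Richardson tableaux are symmetric under reflection of the shape in an antidiagonal
combined with conjugation of the content. -/
theorem HasPattern.antitranspose {R X : ℕ} {lam mu nu : ℕ → ℕ} (h : HasPattern R lam mu nu)
    (hX : ∀ i < R, lam i ≤ X) :
    HasPattern X (fun i => R - conj R mu (X - 1 - i)) (fun i => R - conj R lam (X - 1 - i))
      (conj R nu) := by
  obtain ⟨t, ht⟩ := h
  have hc := ht.isChain hX
  set M := IsPattern.shape mu t with hM
  have hM0 : ∀ j, conj R mu j = IsChain.height R M j 0 := fun j =>
    conj_congr (fun i _ => (IsPattern.shape_zero mu t i).symm) j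
  have hMR : ∀ j, conj R lam j = IsChain.height R M j R := fun j =>
    conj_congr (fun i hi => (ht.shape_of_lt hi hi).symm) j
  have hH : ∀ j k, IsChain.height R M j k ≤ R := IsChain.height_le R M
  -- Row `i` of the reflected diagram is column `X - 1 - i` of the original one. The content of the
  -- last `i` columns is a partition that grows by vertical strips with `i`; conjugated, it gives
  -- the row contents of the reflected tableau.
  refine ⟨fun i c => conj R (IsChain.content R M (X - i)) c, fun c => ?_, fun i hi c => ?_,
    fun i hi c => ?_, fun i hi => ?_, fun i hi c => ?_, fun c => ?_⟩
  · simp only [Nat.sub_zero, conj, hc.content_of_ge]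
    simp
  · obtain ⟨j, rfl⟩ : ∃ j, X = i + j + 1 := ⟨X - i - 1, by omega⟩
    have e1 : i + j + 1 - i = j + 1 := by omega
    have e2 : i + j + 1 - (i + 1) = j := by omega
    rw [e1, e2]
    refine card_le_card fun k hk => ?_
    simp only [mem_filter] at hk ⊢
    exact ⟨hk.1, hk.2.trans_le (hc.content_succ_le j k)⟩
  · obtain ⟨j, rfl⟩ : ∃ j, X = i + j + 1 := ⟨X - i - 1, by omega⟩
    have e1 : i + j + 1 - i = j + 1 := by omega
    have e2 : i + j + 1 - (i + 1) = j := by omega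
    rw [e1, e2]
    refine card_le_card fun k hk => ?_
    simp only [mem_filter] at hk ⊢
    have := hc.content_le_succ j k
    exact ⟨hk.1, by omega⟩
  · obtain ⟨j, rfl⟩ : ∃ j, X = i + j + 1 := ⟨X - i - 1, by omega⟩
    have e1 : i + j + 1 - i = j + 1 := by omega
    have e2 : i + j + 1 - (i + 1) = j := by omega
    have e3 : i + j + 1 - 1 - i = j := by omega
    simp only [e1, e2, e3, hM0, hMR]
    unfold conj
    rw [sum_min_eq, sum_min_eq]
    have b1 : ∑ k ∈ range R, min (IsChain.content R M j k) (i + 1) =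
        ∑ k ∈ range R, IsChain.content R M j k :=
      sum_congr rfl fun k _ => min_eq_left (hc.content_le (i + 1) j (by omega) k)
    have b2 : ∑ k ∈ range R, min (IsChain.content R M (j + 1) k) (i + 1) =
        ∑ k ∈ range R, IsChain.content R M (j + 1) k :=
      sum_congr rfl fun k _ =>
        min_eq_left ((hc.content_le i (j + 1) (by omega) k).trans (by omega))
    rw [b1, b2]
    have s1 := hc.sum_content j R
    have s2 := hc.sum_content (j + 1) R
    have s3 := IsChain.area_eq R M j 0
    have s4 := IsChain.area_eq R M j R
    have := hH j 0
    have := hH j R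
    omega
  · obtain ⟨j, rfl⟩ : ∃ j, X = i + j + 2 := ⟨X - i - 2, by omega⟩
    have e1 : i + j + 2 - i = j + 2 := by omega
    have e2 : i + j + 2 - (i + 1) = j + 1 := by omega
    have e3 : i + j + 2 - (i + 2) = j := by omega
    have e4 : i + j + 2 - 1 - i = j + 1 := by omega
    have e5 : i + j + 2 - 1 - (i + 1) = j := by omega
    simp only [e1, e2, e3, e4, e5, hMR]
    unfold conj
    rw [sum_min_eq, sum_min_eq, sum_min_eq, sum_min_eq]
    have := hc.sum_min_content_le j c
    have := hH j R
    have := hH (j + 1) R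
    omega
  · simp only [Nat.sub_self]
    refine conj_congr (fun k _ => ?_) c
    have h0 : ∀ k, IsChain.area R M 0 k = ∑ r ∈ range R, M r k := fun k => by
      simp [IsChain.area]
    have h1 := hc.area_succ 0 k
    have h2 : ∑ r ∈ range R, M r (k + 1) = ∑ r ∈ range R, M r k + t R k :=
      ht.sum_shape_succ le_rfl k
    rw [h0, h0, h2, ht.final] at h1
    omega

end SkewChar

/-! ### Littlewood–Richardson tableaux correspond to patterns. -/

namespace SkewChar

open Finset YoungDiagram

/-- Empty rows contain no entries, so the last counts are repeated. Diagrams of different lengths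
thereby get patterns with a common number of rows. -/
theorem HasPattern.extend {R R' : ℕ} {lam mu nu : ℕ → ℕ} (h : HasPattern R lam mu nu)
    (hR : R ≤ R') (hl : ∀ i, R ≤ i → lam i = 0) (hm : ∀ i, R ≤ i → mu i = 0) :
    HasPattern R' lam mu nu := by
  obtain ⟨t, ht⟩ := h
  have hanti : ∀ k, t R (k + 1) ≤ t R k := by
    intro k
    rcases Nat.eq_zero_or_pos R with rfl | h0
    · simp [ht.zero]
    · obtain ⟨r, rfl⟩ : ∃ r, R = r + 1 := ⟨R - 1, by omega⟩
      exact (ht.inter r (by omega) k).trans (ht.mono r (by omega) k)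
  refine ⟨fun i => t (min i R), fun k => ?_, fun i hi k => ?_, fun i hi k => ?_, fun i hi => ?_,
    fun i hi k => ?_, fun k => ?_⟩
  · simp [ht.zero]
  · rcases lt_or_ge i R with h1 | h1
    · rw [min_eq_left h1.le, min_eq_left h1]; exact ht.mono i h1 k
    · rw [min_eq_right h1, min_eq_right (by omega)]
  · rcases lt_or_ge i R with h1 | h1
    · rw [min_eq_left h1.le, min_eq_left h1]; exact ht.inter i h1 k
    · rw [min_eq_right h1, min_eq_right (by omega)]; exact hanti k
  · rcases lt_or_ge i R with h1 | h1
    · rw [min_eq_left h1.le, min_eq_left h1]; exact ht.row i h1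
    · rw [min_eq_right h1, min_eq_right (by omega), hl i h1, hm i h1]
  · rcases lt_or_ge (i + 1) R with h1 | h1
    · rw [min_eq_left (by omega : i ≤ R), min_eq_left (by omega : i + 1 ≤ R),
        min_eq_left (by omega : i + 2 ≤ R)]
      exact ht.ss i h1 k
    · rw [min_eq_right h1, min_eq_right (by omega : R ≤ i + 2), hm _ h1]
      have : ∑ l ∈ range k, t (min i R) l ≤ ∑ l ∈ range k, t R l := by
        refine sum_le_sum fun l _ => ?_
        rcases lt_or_ge i R with h2 | h2
        · have : i + 1 = R := by omega
          rw [min_eq_left h2.le]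
          calc t i l ≤ t (i + 1) l := ht.mono i h2 l
            _ = t R l := by rw [this]
        · rw [min_eq_right h2]
      omega
  · rw [min_eq_right hR]; exact ht.final k

theorem mem_skewCells {lam mu : YoungDiagram} {i j : ℕ} :
    (i, j) ∈ skewCells lam mu ↔ mu.rowLen i ≤ j ∧ j < lam.rowLen i := by
  rw [skewCells, mem_sdiff, mem_cells, mem_cells, mem_iff_lt_rowLen, mem_iff_lt_rowLen, not_lt,
    and_comm]

/-- The number of entries `b` in row `i` of a filling. -/
def rowCount (lam mu : YoungDiagram) (T : ℕ → ℕ → ℕ) (i b : ℕ) : ℕ :=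
  ((Ico (mu.rowLen i) (lam.rowLen i)).filter fun j => T i j = b).card

theorem count_row (lam mu : YoungDiagram) (T : ℕ → ℕ → ℕ) (i b : ℕ) :
    (((List.range' (mu.rowLen i) (lam.rowLen i - mu.rowLen i)).reverse).map (T i)).count b =
      rowCount lam mu T i b := by
  rw [List.map_reverse, List.count_reverse, List.count, List.countP_map, rowCount, Finset.card,
    Finset.filter_val, ← Multiset.countP_eq_card_filter, Nat.Ico_eq_range', Multiset.coe_countP]
  refine List.countP_congr fun j _ => ?_
  simp

theorem count_rows (lam mu : YoungDiagram) (T : ℕ → ℕ → ℕ) (n b : ℕ) :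
    ((List.range n).flatMap fun i =>
      ((List.range' (mu.rowLen i) (lam.rowLen i - mu.rowLen i)).reverse).map (T i)).count b =
      ∑ i ∈ range n, rowCount lam mu T i b := by
  induction n with
  | zero => simp
  | succ n ih =>
    rw [List.range_succ, List.flatMap_append, List.count_append, ih, sum_range_succ]
    simp only [List.flatMap_cons, List.flatMap_nil, List.append_nil]
    rw [count_row]

theorem card_skewCells_filter (lam mu : YoungDiagram) (T : ℕ → ℕ → ℕ) (b : ℕ) {R : ℕ}
    (hR : lam.colLen 0 ≤ R) :
    ((skewCells lam mu).filter fun c => T c.1 c.2 = b).card =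
      ∑ i ∈ range R, rowCount lam mu T i b := by
  rw [card_eq_sum_card_fiberwise (f := Prod.fst) (t := range R)]
  · refine sum_congr rfl fun i _ => ?_
    rw [rowCount, ← card_image_of_injective
      ((Ico (mu.rowLen i) (lam.rowLen i)).filter fun j => T i j = b) (Prod.mk_right_injective i)]
    refine congrArg Finset.card ?_
    ext ⟨r, j⟩
    simp only [mem_filter, mem_skewCells, mem_image, mem_Ico, Prod.mk.injEq]
    constructor
    · rintro ⟨⟨h1, h2⟩, rfl⟩
      exact ⟨j, ⟨h1, h2⟩, rfl, rfl⟩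
    · rintro ⟨j', ⟨h1, h2⟩, rfl, rfl⟩
      exact ⟨⟨h1, h2⟩, rfl⟩
  · rintro ⟨i, j⟩ h
    simp only [coe_filter, Set.mem_ofPred_eq, mem_skewCells] at h
    have := rowLen_eq_zero_iff lam i
    simp only [coe_range, Set.mem_Iio]
    omega

theorem exists_take_flatMap (F : ℕ → List ℕ) (R n : ℕ) :
    ∃ i m, i ≤ R ∧ (i = R → R = 0) ∧
      ((List.range R).flatMap F).take n = (List.range i).flatMap F ++ if i < R then (F i).take m else [] := by
  induction R with
  | zero => exact ⟨0, 0, by simp⟩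
  | succ R ih =>
    rw [List.range_succ, List.flatMap_append, List.take_append]
    rcases le_or_gt n ((List.range R).flatMap F).length with h | h
    · obtain ⟨i, m, hi, hi', h'⟩ := ih
      rw [h', Nat.sub_eq_zero_of_le h]
      rcases hi.eq_or_lt with rfl | hlt
      · refine ⟨i, 0, by omega, by omega, ?_⟩
        simp
      · refine ⟨i, m, by omega, by omega, ?_⟩
        simp [hlt, show i < R + 1 by omega]
    · refine ⟨R, n - ((List.range R).flatMap F).length, by omega, by omega, ?_⟩
      rw [List.take_of_length_le h.le]
      simp

section Tableau

variable {lam mu nu : YoungDiagram} (T : LRTableau lam mu nu)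

/-- The number of entries `k + 1` in the first `i` rows. -/
def LRTableau.counts (i k : ℕ) : ℕ := ∑ r ∈ range i, rowCount lam mu T.entry r (k + 1)

/-- Rows weakly increase, so the entries at most `k` fill an initial segment of the row, whose
length is counted letter by letter. -/
theorem LRTableau.entry_le_iff (i k j : ℕ) (hj : mu.rowLen i ≤ j) (hj' : j < lam.rowLen i) :
    T.entry i j ≤ k ↔ j < mu.rowLen i + ∑ l ∈ range k, rowCount lam mu T.entry i (l + 1) := by
  have hsum : ∑ l ∈ range k, rowCount lam mu T.entry i (l + 1) =
      ((range (lam.rowLen i - mu.rowLen i)).filter fun m => T.entry i (mu.rowLen i + m) ≤ k).card := by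
    have h1 : ((range (lam.rowLen i - mu.rowLen i)).filter
        fun m => T.entry i (mu.rowLen i + m) ≤ k).card =
        ((Ico (mu.rowLen i) (lam.rowLen i)).filter fun j => T.entry i j ≤ k).card := by
      rw [← card_image_of_injective ((range (lam.rowLen i - mu.rowLen i)).filter
        fun m => T.entry i (mu.rowLen i + m) ≤ k) (add_right_injective (mu.rowLen i))]
      refine congrArg Finset.card ?_
      ext x
      simp only [mem_image, mem_filter, mem_range, mem_Ico]
      constructor
      · rintro ⟨m, ⟨h1, h2⟩, rfl⟩
        exact ⟨⟨by omega, by omega⟩, h2⟩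
      · rintro ⟨⟨h1, h2⟩, h3⟩
        exact ⟨x - mu.rowLen i, ⟨by omega, by rwa [Nat.add_sub_cancel' h1]⟩, by omega⟩
    rw [h1, card_eq_sum_card_fiberwise (f := fun j => T.entry i j - 1) (t := range k)]
    · refine sum_congr rfl fun l hl => ?_
      rw [rowCount, filter_filter]
      congr 1
      refine filter_congr fun x hx => ?_
      have := T.pos i x (mem_skewCells.2 (mem_Ico.1 hx))
      have := mem_range.1 hl
      omega
    · intro x hx
      simp only [coe_filter, mem_Ico, Set.mem_ofPred_eq] at hx
      have := T.pos i x (mem_skewCells.2 hx.1)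
      simp only [coe_range, Set.mem_Iio]
      omega
  have hth := lt_card_filter_range (R := lam.rowLen i - mu.rowLen i)
    (p := fun m => T.entry i (mu.rowLen i + m) ≤ k) (fun m hm h => by
      refine (T.row_weak i _ _ ?_ ?_ ?_).trans h
      · omega
      · rw [mem_skewCells]; omega
      · rw [mem_skewCells]; omega) (j - mu.rowLen i) (by omega)
  rw [← hsum] at hth
  rw [Nat.add_sub_cancel' hj] at hth
  rw [hth]
  omega

theorem LRTableau.counts_inter (i k : ℕ) (hi : i < lam.colLen 0) :
    T.counts (i + 1) (k + 1) ≤ T.counts i k := by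
  set F : ℕ → List ℕ := fun i =>
    ((List.range' (mu.rowLen i) (lam.rowLen i - mu.rowLen i)).reverse).map (T.entry i) with hF
  -- Rows are read from right to left, so the large entries of row `i` come first. Stopping right
  -- after those `≥ k + 2` collects every `k + 2` of the first `i + 1` rows, but the letters `k + 1`
  -- of the first `i` rows only.
  obtain ⟨n, hn⟩ : ∃ n, (reverseRowWord lam mu T.entry).take n =
      (List.range i).flatMap F ++ (F i).takeWhile (fun x => k + 2 ≤ x) := by
    refine ⟨_, (List.prefix_iff_eq_take.1 ?_).symm⟩
    have h1 : List.range (lam.colLen 0) =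
        List.range i ++ i :: (List.range' (i + 1) (lam.colLen 0 - i - 1)) := by
      have h2 := List.range'_append_1 (s := 0) (m := i) (n := lam.colLen 0 - i - 1 + 1)
      rw [List.range_eq_range', List.range_eq_range', ← List.range'_succ]
      rw [Nat.zero_add] at h2
      rw [h2]
      congr 1
      omega
    rw [reverseRowWord, h1, List.flatMap_append, List.prefix_append_right_inj, List.flatMap_cons]
    exact (List.takeWhile_prefix _).trans (List.prefix_append _ _)
  have hlat := T.lattice (k + 1) n (by omega)
  rw [hn, List.count_append, List.count_append, count_rows, count_rows] at hlat
  have hpw : (F i).Pairwise (· ≥ ·) := by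
    rw [hF]
    simp only
    rw [List.pairwise_map, List.pairwise_reverse]
    refine List.Pairwise.imp_of_mem ?_ List.pairwise_lt_range'
    intro a b ha hb hab
    rw [List.mem_range'_1] at ha hb
    exact T.row_weak i a b hab (mem_skewCells.2 (by omega)) (mem_skewCells.2 (by omega))
  have hcnt : ∀ l : List ℕ, l.Pairwise (· ≥ ·) →
      (l.takeWhile (fun x => k + 2 ≤ x)).count (k + 1 + 1) = l.count (k + 1 + 1) ∧
      (l.takeWhile (fun x => k + 2 ≤ x)).count (k + 1) = 0 := by
    intro l hl
    induction l with
    | nil => simp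
    | cons a l ih =>
      rw [List.pairwise_cons] at hl
      by_cases ha : k + 2 ≤ a
      · rw [List.takeWhile_cons_of_pos (by simpa using ha), List.count_cons, List.count_cons,
          List.count_cons]
        have := ih hl.2
        refine ⟨by rw [this.1], ?_⟩
        rw [this.2]
        have : ¬ a = k + 1 := by omega
        simp [this]
      · rw [List.takeWhile_cons_of_neg (by simpa using ha)]
        refine ⟨?_, by simp⟩
        rw [List.count_nil, eq_comm, List.count_eq_zero, List.mem_cons]
        rintro (h | h)
        · omega
        · have := hl.1 _ h
          omega
  rw [(hcnt _ hpw).1, (hcnt _ hpw).2, count_row] at hlat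
  rw [counts, counts, sum_range_succ]
  simpa using hlat

theorem LRTableau.isPattern :
    IsPattern (lam.colLen 0) lam.rowLen mu.rowLen nu.rowLen T.counts := by
  have hs : ∀ i k, T.counts (i + 1) k = T.counts i k + rowCount lam mu T.entry i (k + 1) :=
    fun i k => sum_range_succ _ _
  have hsum : ∀ i k, ∑ l ∈ range k, T.counts (i + 1) l =
      ∑ l ∈ range k, T.counts i l + ∑ l ∈ range k, rowCount lam mu T.entry i (l + 1) := by
    intro i k
    rw [← sum_add_distrib]
    exact sum_congr rfl fun l _ => hs i l
  have hmu : ∀ i, mu.rowLen i ≤ lam.rowLen i := le_iff_rowLen_le.1 T.subset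
  have hzero : ∀ i, i ≤ lam.colLen 0 → ∀ l, i ≤ l → T.counts i l = 0 := by
    intro i
    induction i with
    | zero => intro _ l _; rfl
    | succ i ih =>
      intro hi l hl
      obtain ⟨l', rfl⟩ : ∃ l', l = l' + 1 := ⟨l - 1, by omega⟩
      have := T.counts_inter i l' (by omega)
      rw [ih (by omega) l' (by omega)] at this
      omega
  have hle : ∀ i k, mu.rowLen i + ∑ l ∈ range k, rowCount lam mu T.entry i (l + 1) ≤
      lam.rowLen i := by
    intro i k
    by_contra! hc
    have hlt : ∑ l ∈ range k, rowCount lam mu T.entry i (l + 1) ≤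
        (Ico (mu.rowLen i) (lam.rowLen i)).card := by
      unfold rowCount
      rw [← card_biUnion]
      · refine card_le_card fun x hx => ?_
        simp only [mem_biUnion, mem_filter] at hx
        obtain ⟨_, _, h, _⟩ := hx
        exact h
      · intro a _ b _ hab
        rw [Function.onFun, disjoint_left]
        intro x hx hx'
        simp only [mem_filter] at hx hx'
        omega
    rw [Nat.card_Ico] at hlt
    have := hmu i
    omega
  refine ⟨fun k => rfl, fun i _ k => ?_, fun i hi k => T.counts_inter i k hi, fun i hi => ?_,
    fun i hi k => ?_, fun k => ?_⟩
  · rw [hs]; omega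
  · rw [hsum]
    have h1 := hle i (i + 1)
    -- If the entries at most `i + 1` did not fill row `i`, the next box would carry a larger
    -- letter; `hzero` excludes such letters from the first `i + 1` rows.
    by_contra hne
    have hlt : mu.rowLen i + ∑ l ∈ range (i + 1), rowCount lam mu T.entry i (l + 1) <
        lam.rowLen i := by omega
    set j := mu.rowLen i + ∑ l ∈ range (i + 1), rowCount lam mu T.entry i (l + 1) with hj
    have h2 := T.entry_le_iff i (i + 1) j (by omega) hlt
    rw [← hj] at h2
    have h3 : i + 1 < T.entry i j := by
      by_contra! h4
      exact lt_irrefl _ (h2.1 h4)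
    have h4 : 0 < rowCount lam mu T.entry i (T.entry i j - 1 + 1) := by
      refine card_pos.2 ⟨j, ?_⟩
      simp only [mem_filter, mem_Ico]
      omega
    have h5 := hs i (T.entry i j - 1)
    have h6 := hzero (i + 1) hi (T.entry i j - 1) (by omega)
    omega
  · rw [hsum (i + 1), hsum i k]
    suffices h : mu.rowLen (i + 1) + ∑ l ∈ range (k + 1), rowCount lam mu T.entry (i + 1) (l + 1) ≤
        mu.rowLen i + ∑ l ∈ range k, rowCount lam mu T.entry i (l + 1) by omega
    by_contra! hc
    set x := mu.rowLen i + ∑ l ∈ range k, rowCount lam mu T.entry i (l + 1) with hx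
    have h1 := hle (i + 1) (k + 1)
    have h2 := mu.rowLen_anti i (i + 1) (by omega)
    have h3 := lam.rowLen_anti i (i + 1) (by omega)
    have h4 := (T.entry_le_iff (i + 1) (k + 1) x (by omega) (by omega)).2 hc
    have h5 := T.entry_le_iff i k x (by omega) (by omega)
    rw [← hx] at h5
    have h6 : ¬ T.entry i x ≤ k := fun h => lt_irrefl _ (h5.1 h)
    have h7 := T.col_strict i (i + 1) x (by omega) (mem_skewCells.2 (by omega))
      (mem_skewCells.2 (by omega))
    omega
  · rw [← T.content k, card_skewCells_filter lam mu T.entry (k + 1) le_rfl]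
    rfl

end Tableau

section OfPattern

variable {lam mu nu : YoungDiagram} {R : ℕ} {t : ℕ → ℕ → ℕ}

open IsPattern

/-- The filling of `lam / mu` described by a pattern. -/
noncomputable def patternEntry (lam mu : YoungDiagram) (t : ℕ → ℕ → ℕ) (i j : ℕ) : ℕ :=
  if mu.rowLen i ≤ j ∧ j < lam.rowLen i then sInf {k | j < shape mu.rowLen t i k} else 0

theorem patternEntry_le_iff (h : IsPattern R lam.rowLen mu.rowLen nu.rowLen t)
    {i j : ℕ} (hi : i < R) (hj : mu.rowLen i ≤ j) (hj' : j < lam.rowLen i) (k : ℕ) :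
    patternEntry lam mu t i j ≤ k ↔ j < shape mu.rowLen t i k := by
  rw [patternEntry, if_pos ⟨hj, hj'⟩]
  have hne : {k | j < shape mu.rowLen t i k}.Nonempty :=
    ⟨i + 1, by rw [Set.mem_ofPred_eq, h.shape_of_lt hi (Nat.lt_succ_self i)]; exact hj'⟩
  constructor
  · intro hk
    have h1 := Nat.sInf_mem hne
    rw [Set.mem_ofPred_eq] at h1
    exact h1.trans_le (shape_mono _ _ _ hk)
  · intro hk
    exact Nat.sInf_le hk

theorem rowCount_patternEntry (h : IsPattern R lam.rowLen mu.rowLen nu.rowLen t)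
    {i : ℕ} (hi : i < R) (k : ℕ) :
    rowCount lam mu (patternEntry lam mu t) i (k + 1) = t (i + 1) k - t i k := by
  have : (Ico (mu.rowLen i) (lam.rowLen i)).filter (fun j => patternEntry lam mu t i j = k + 1) =
      Ico (shape mu.rowLen t i k) (shape mu.rowLen t i (k + 1)) := by
    ext j
    simp only [mem_filter, mem_Ico]
    constructor
    · rintro ⟨⟨h1, h2⟩, h3⟩
      have := patternEntry_le_iff h hi h1 h2 k
      have := patternEntry_le_iff h hi h1 h2 (k + 1)
      omega
    · rintro ⟨h1, h2⟩
      have h3 : mu.rowLen i ≤ j := by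
        rw [← shape_zero mu.rowLen t i]
        exact (shape_mono _ _ _ (Nat.zero_le k)).trans h1
      have h4 := h.shape_le hi (k + 1)
      have := patternEntry_le_iff h hi h3 (by omega) k
      have := patternEntry_le_iff h hi h3 (by omega) (k + 1)
      omega
  rw [rowCount, this, Nat.card_Ico, shape_succ]
  omega

theorem sum_rowCount_patternEntry (h : IsPattern R lam.rowLen mu.rowLen nu.rowLen t)
    {i : ℕ} (hi : i ≤ R) (k : ℕ) :
    ∑ r ∈ range i, rowCount lam mu (patternEntry lam mu t) r (k + 1) = t i k := by
  induction i with
  | zero => simp [h.zero]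
  | succ i ih =>
    rw [sum_range_succ, ih (by omega), rowCount_patternEntry h (by omega)]
    have := h.mono i (by omega) k
    omega

/-- The Littlewood–Richardson tableau described by a pattern. -/
noncomputable def LRTableau.ofPattern (hsub : mu ≤ lam) (hR : lam.colLen 0 ≤ R)
    (h : IsPattern R lam.rowLen mu.rowLen nu.rowLen t) : LRTableau lam mu nu where
  entry := patternEntry lam mu t
  subset := hsub
  zero_off i j hij := by
    rw [mem_skewCells] at hij
    rw [patternEntry, if_neg hij]
  pos i j hij := by
    rw [mem_skewCells] at hij
    have hi : i < R := by have := rowLen_eq_zero_iff lam i; omega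
    have := patternEntry_le_iff h hi hij.1 hij.2 0
    rw [shape_zero] at this
    omega
  row_weak i j₁ j₂ hj h₁ h₂ := by
    rw [mem_skewCells] at h₁ h₂
    have hi : i < R := by have := rowLen_eq_zero_iff lam i; omega
    rw [patternEntry_le_iff h hi h₁.1 h₁.2]
    exact hj.trans ((patternEntry_le_iff h hi h₂.1 h₂.2 _).1 le_rfl)
  col_strict i₁ i₂ j hi h₁ h₂ := by
    rw [mem_skewCells] at h₁ h₂
    have hi₂ : i₂ < R := by have := rowLen_eq_zero_iff lam i₂; omega
    have h3 := (patternEntry_le_iff h hi₂ h₂.1 h₂.2 _).1 le_rfl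
    have key : ∀ k i, i₁ + 1 ≤ i → i < R → shape mu.rowLen t i (k + 1) ≤ shape mu.rowLen t i₁ k := by
      intro k i hi₁
      induction i, hi₁ using Nat.le_induction with
      | base => intro hR; exact h.shape_strip hR k
      | succ i hi₁ ih =>
        intro hR
        exact ((h.shape_strip hR k).trans (shape_mono _ _ _ (Nat.le_succ k))).trans (ih (by omega))
    have h4 : patternEntry lam mu t i₂ j ≠ 0 := by
      intro h0
      rw [h0, shape_zero] at h3
      omega
    obtain ⟨k, hk⟩ := Nat.exists_eq_succ_of_ne_zero h4
    rw [hk] at h3 ⊢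
    have h5 := (patternEntry_le_iff h (by omega) h₁.1 h₁.2 k).2
      (h3.trans_le (key k i₂ hi hi₂))
    omega
  content k := by
    rw [card_skewCells_filter lam mu _ (k + 1) hR, sum_rowCount_patternEntry h le_rfl, h.final]
  lattice i n hi := by
    obtain ⟨k, rfl⟩ : ∃ k, i = k + 1 := ⟨i - 1, by omega⟩
    set F : ℕ → List ℕ := fun i => ((List.range' (mu.rowLen i)
      (lam.rowLen i - mu.rowLen i)).reverse).map (patternEntry lam mu t i) with hF
    -- A prefix ends inside some row `i`: it has at most the letters `k + 2` of the first `i + 1`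
    -- rows and at least the letters `k + 1` of the first `i` rows.
    obtain ⟨i, m, hi, hi', hw⟩ := exists_take_flatMap F (lam.colLen 0) n
    rw [reverseRowWord, hw]
    split_ifs with hlt
    · rw [List.count_append, List.count_append, count_rows, count_rows,
        sum_rowCount_patternEntry h (by omega), sum_rowCount_patternEntry h (by omega)]
      have h1 : ((F i).take m).count (k + 1 + 1) ≤ (F i).count (k + 1 + 1) :=
        (List.take_sublist m (F i)).count_le _
      have h0 : (F i).count (k + 1 + 1) = _ := count_row lam mu (patternEntry lam mu t) i (k + 1 + 1)
      rw [h0, rowCount_patternEntry h (by omega)] at h1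
      have h2 := h.inter i (by omega) k
      have h3 := h.mono i (by omega) (k + 1)
      omega
    · have : i = 0 := by omega
      subst this
      simp

end OfPattern

theorem mem_components_iff {lam mu nu : YoungDiagram} {R : ℕ} (hR : lam.colLen 0 ≤ R) :
    nu ∈ components lam mu ↔ mu ≤ lam ∧ HasPattern R lam.rowLen mu.rowLen nu.rowLen := by
  rw [components, Set.mem_ofPred_eq, lrCoeff, Nat.card_ne_zero]
  constructor
  · rintro ⟨⟨T⟩, _⟩
    have hle := le_iff_rowLen_le.1 T.subset
    refine ⟨T.subset, HasPattern.extend ⟨_, T.isPattern⟩ hR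
      (fun i hi => (rowLen_eq_zero_iff lam i).2 hi) fun i hi => ?_⟩
    have := (rowLen_eq_zero_iff lam i).2 hi
    have := hle i
    omega
  · rintro ⟨hsub, t, ht⟩
    exact ⟨⟨LRTableau.ofPattern hsub hR ht⟩, inferInstance⟩

end SkewChar

/-! ### Constructing components: sums, unions and isolated boxes. -/

namespace SkewChar

open Finset YoungDiagram

theorem conj_rowLen (a : YoungDiagram) {R : ℕ} (hR : a.colLen 0 ≤ R) (j : ℕ) :
    conj R a.rowLen j = a.colLen j := by
  rw [conj, ← card_range (a.colLen j)]
  congr 1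
  ext i
  rw [mem_filter, mem_range, mem_range, lt_rowLen_iff_lt_colLen]
  have := a.colLen_anti 0 j (Nat.zero_le j)
  omega

/-- Complementing and reflecting in a rectangle is an involution; this undoes the first of two
applications of `HasPattern.antitranspose`. -/
theorem sub_conj_reflect (u : YoungDiagram) {X N : ℕ} (hX : u.rowLen 0 ≤ X) (hN : u.colLen 0 ≤ N)
    {i : ℕ} (hi : i < N) :
    X - conj X (fun i' => N - u.colLen (X - 1 - i')) (N - 1 - i) = u.rowLen i := by
  have h1 : conj X (fun i' => N - u.colLen (X - 1 - i')) (N - 1 - i) =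
      ((range X).filter fun j => ¬ i < u.colLen j).card := by
    rw [conj, card_filter, card_filter,
      ← sum_range_reflect (fun j => if ¬ i < u.colLen j then 1 else 0) X]
    refine sum_congr rfl fun i' _ => ?_
    have := u.colLen_anti 0 (X - 1 - i') (Nat.zero_le _)
    congr 1
    apply propext
    omega
  have h2 : ((range X).filter fun j => i < u.colLen j).card = u.rowLen i := by
    rw [← card_range (u.rowLen i)]
    congr 1
    ext j
    rw [mem_filter, mem_range, mem_range, lt_rowLen_iff_lt_colLen]
    have := u.rowLen_anti 0 i (Nat.zero_le i)
    have := lt_rowLen_iff_lt_colLen u i j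
    omega
  have h3 := card_filter_add_card_filter_not (s := range X) (fun j => i < u.colLen j)
  rw [card_range] at h3
  omega

theorem le_of_mem_components {lam mu nu : YoungDiagram} (h : nu ∈ components lam mu) : mu ≤ lam :=
  ((mem_components_iff le_rfl).1 h).1

theorem hasPattern_of_mem_components {lam mu nu : YoungDiagram} (h : nu ∈ components lam mu) :
    HasPattern (lam.colLen 0) lam.rowLen mu.rowLen nu.rowLen :=
  ((mem_components_iff le_rfl).1 h).2

theorem components_add {lam mu nu lam' mu' nu' : YoungDiagram} (h : nu ∈ components lam mu)
    (h' : nu' ∈ components lam' mu') : add nu nu' ∈ components (add lam lam') (add mu mu') := by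
  set R := lam.colLen 0 + lam'.colLen 0 + (add lam lam').colLen 0
  rw [mem_components_iff (R := R) (by omega)] at h h' ⊢
  exact ⟨add_le_add' h.1 h'.1, (h.2.add h'.2).congr (by simp) (by simp) (by simp)⟩

theorem colLen_le_of_hasPattern {R : ℕ} {lam mu : ℕ → ℕ} {nu : YoungDiagram}
    (h : HasPattern R lam mu nu.rowLen) : nu.colLen 0 ≤ R := by
  obtain ⟨t, ht⟩ := h
  rw [← rowLen_eq_zero_iff, ← ht.final]
  exact ht.eq_zero_of_le le_rfl R le_rfl

/-- Taking the union adds column lengths, which the reflection turns into row lengths: reflect both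
patterns, add them, and reflect back. -/
theorem components_union {lam mu nu lam' mu' nu' : YoungDiagram} (h : nu ∈ components lam mu)
    (h' : nu' ∈ components lam' mu') :
    union nu nu' ∈ components (union lam lam') (union mu mu') := by
  have hs := le_of_mem_components h
  have hs' := le_of_mem_components h'
  have hp := hasPattern_of_mem_components h
  have hp' := hasPattern_of_mem_components h'
  have hm0 := le_iff_colLen_le.1 hs 0
  have hm0' := le_iff_colLen_le.1 hs' 0
  have hn0 := colLen_le_of_hasPattern hp
  have hn0' := colLen_le_of_hasPattern hp'
  set R := lam.colLen 0 with hR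
  set R' := lam'.colLen 0 with hR'
  have hsu := union_le_union hs hs'
  -- Any common bound for these first rows will do; both patterns must be reflected in rectangles of
  -- the same width.
  set X := (union lam lam').rowLen 0 + lam.rowLen 0 + lam'.rowLen 0 + (union nu nu').rowLen 0 with hX
  have hmX := le_iff_rowLen_le.1 hsu 0
  have ha := hp.antitranspose (X := X) fun i _ => (lam.rowLen_anti 0 i (Nat.zero_le i)).trans (by omega)
  have ha' := hp'.antitranspose (X := X)
    fun i _ => (lam'.rowLen_anti 0 i (Nat.zero_le i)).trans (by omega)
  have hb := (ha.add ha').antitranspose (X := R + R') fun i _ => by omega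
  rw [mem_components_iff (R := R + R') (by simp [hR, hR'])]
  refine ⟨hsu, hb.congr (fun i hi => ?_) (fun i hi => ?_) fun i => ?_⟩
  · rw [← sub_conj_reflect (union lam lam') (X := X) (N := R + R') (by omega) (by simp [hR, hR']) hi]
    congr 1
    refine conj_congr (fun i' _ => ?_) _
    rw [conj_rowLen _ le_rfl, conj_rowLen _ le_rfl, colLen_union]
    have := lam.colLen_anti 0 (X - 1 - i') (Nat.zero_le _)
    have := lam'.colLen_anti 0 (X - 1 - i') (Nat.zero_le _)
    omega
  · rw [← sub_conj_reflect (union mu mu') (X := X) (N := R + R') (by omega)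
      (by rw [colLen_union]; omega) hi]
    congr 1
    refine conj_congr (fun i' _ => ?_) _
    rw [conj_rowLen _ hm0, conj_rowLen _ hm0', colLen_union]
    have := mu.colLen_anti 0 (X - 1 - i') (Nat.zero_le _)
    have := mu'.colLen_anti 0 (X - 1 - i') (Nat.zero_le _)
    omega
  · have h1 : conj X (union nu nu').transpose.rowLen i = (union nu nu').transpose.colLen i :=
      conj_rowLen _ (by rw [colLen_transpose]; omega) i
    rw [colLen_transpose] at h1
    rw [← h1]
    refine conj_congr (fun j _ => ?_) i
    rw [rowLen_transpose, colLen_union, conj_rowLen _ hn0, conj_rowLen _ hn0']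

/-- The partition `(r)`. -/
def oneRow (r : ℕ) : YoungDiagram :=
  ofFun (fun i => if i = 0 then r else 0) (fun i j h => by dsimp only; split_ifs <;> omega) 1

theorem rowLen_oneRow (r i : ℕ) : (oneRow r).rowLen i = if i = 0 then r else 0 :=
  rowLen_ofFun _ (by simp) i

theorem colLen_oneRow (r j : ℕ) : (oneRow r).colLen j = if j < r then 1 else 0 := by
  have h0 := lt_rowLen_iff_lt_colLen (oneRow r) 0 j
  have h1 := lt_rowLen_iff_lt_colLen (oneRow r) 1 j
  rw [rowLen_oneRow] at h0 h1
  simp only [if_true, one_ne_zero, if_false] at h0 h1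
  split_ifs <;> omega

theorem oneRow_mem_components {r s : ℕ} (h : s ≤ r) :
    oneRow (r - s) ∈ components (oneRow r) (oneRow s) := by
  rw [mem_components_iff (R := 1) (by rw [colLen_oneRow]; split_ifs <;> omega)]
  refine ⟨le_iff_rowLen_le.2 fun i => ?_, fun i k => if i = 1 ∧ k = 0 then r - s else 0,
    fun k => ?_, fun i hi k => ?_, fun i hi k => ?_, fun i hi => ?_, fun i hi k => ?_, fun k => ?_⟩
  · rw [rowLen_oneRow, rowLen_oneRow]; split_ifs <;> omega
  · simp
  · obtain rfl : i = 0 := by omega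
    simp
  · simp
  · obtain rfl : i = 0 := by omega
    simp [rowLen_oneRow]
    omega
  · omega
  · simp [rowLen_oneRow]

/-- The partition without its first part. -/
def tail (a : YoungDiagram) : YoungDiagram :=
  ofFun (fun i => a.rowLen (i + 1)) (fun i j h => a.rowLen_anti _ _ (by omega)) (a.colLen 0)

theorem rowLen_tail (a : YoungDiagram) (i : ℕ) : (tail a).rowLen i = a.rowLen (i + 1) := by
  refine rowLen_ofFun _ ?_ i
  rw [rowLen_eq_zero_iff]
  omega

theorem union_oneRow_tail (a : YoungDiagram) : union (oneRow (a.rowLen 0)) (tail a) = a := by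
  apply ext_colLen
  intro j
  rw [colLen_union, colLen_oneRow]
  have h0 := lt_rowLen_iff_lt_colLen a 0 j
  have h1 : ∀ i, i < (tail a).colLen j ↔ i + 1 < a.colLen j := fun i => by
    rw [← lt_rowLen_iff_lt_colLen, rowLen_tail, lt_rowLen_iff_lt_colLen]
  have h2 := h1 ((tail a).colLen j)
  have h3 := h1 (a.colLen j - 1)
  have h4 := h1 (a.colLen j - 2)
  split_ifs <;> omega

theorem bot_mem_components : (⊥ : YoungDiagram) ∈ components ⊥ ⊥ := by
  have h : ∀ i, (⊥ : YoungDiagram).rowLen i = 0 := fun i => by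
    by_contra hne
    exact notMem_bot (i, 0) (mem_iff_lt_rowLen.2 (by omega))
  have h0 : (⊥ : YoungDiagram).colLen 0 = 0 := by
    have := (rowLen_eq_zero_iff ⊥ 0).1 (h 0)
    omega
  rw [mem_components_iff (R := 0) h0.le]
  exact ⟨le_rfl, fun _ _ => 0, fun k => rfl, fun i hi => by omega, fun i hi => by omega,
    fun i hi => by omega, fun i hi => by omega, fun k => (h k).symm⟩

theorem rowLen_bot (i : ℕ) : (⊥ : YoungDiagram).rowLen i = 0 := by
  by_contra hne
  exact notMem_bot (i, 0) (mem_iff_lt_rowLen.2 (by omega))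

theorem colLen_bot (i : ℕ) : (⊥ : YoungDiagram).colLen i = 0 := by
  by_contra hne
  exact notMem_bot (0, i) (mem_iff_lt_colLen.2 (by omega))

/-- A single skew row has a component, and a skew diagram is the union of its first row and the
rest. -/
theorem components_nonempty {lam mu : YoungDiagram} (h : mu ≤ lam) : (components lam mu).Nonempty := by
  have key : ∀ n, ∀ lam mu : YoungDiagram, lam.colLen 0 ≤ n → mu ≤ lam →
      (components lam mu).Nonempty := by
    intro n
    induction n with
    | zero =>
      intro lam mu hn h
      have h1 : lam = ⊥ := ext_rowLen fun i => by
        rw [rowLen_bot, rowLen_eq_zero_iff]; omega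
      subst h1
      obtain rfl : mu = ⊥ := le_bot_iff.1 h
      exact ⟨⊥, bot_mem_components⟩
    | succ n ih =>
      intro lam mu hn h
      have h' := le_iff_rowLen_le.1 h
      obtain ⟨nu, hnu⟩ := ih (tail lam) (tail mu) (by
        rw [← rowLen_eq_zero_iff, rowLen_tail, rowLen_eq_zero_iff]; exact hn)
        (le_iff_rowLen_le.2 fun i => by rw [rowLen_tail, rowLen_tail]; exact h' _)
      have := components_union (oneRow_mem_components (h' 0)) hnu
      rw [union_oneRow_tail, union_oneRow_tail] at this
      exact ⟨_, this⟩
  exact key _ lam mu le_rfl h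

theorem sum_add_indicator (f : ℕ → ℕ) (c n : ℕ) :
    ∑ l ∈ range n, (f l + if l = c then 1 else 0) = ∑ l ∈ range n, f l + if c < n then 1 else 0 := by
  rw [sum_add_distrib, sum_ite_eq']
  simp

/-- The letters that a box which starts as a letter `k` below row `R` passes through as it slides
upwards through the rows of a pattern. -/
def slideIndex (t : ℕ → ℕ → ℕ) (R k : ℕ) : ℕ → ℕ
  | 0 => k
  | d + 1 =>
    if slideIndex t R k d = 0 ∨
        t (R - d) (slideIndex t R k d) < t (R - d - 1) (slideIndex t R k d - 1) then
      slideIndex t R k d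
    else slideIndex t R k d - 1

/-- Inserting an isolated box into the shape adds an arbitrary box to a component: the new
tableau is obtained by sliding the box upwards through the rows below the isolated box. -/
theorem HasPattern.insert_box {R i₀ e k : ℕ} {lam mu nu lam' mu' nu' : ℕ → ℕ}
    (h : HasPattern R lam' mu' nu') (hi₀ : i₀ ≤ R)
    (hl1 : ∀ i < i₀, lam i = lam' i + 1) (hl2 : lam i₀ = e + 1)
    (hl3 : ∀ i, i₀ ≤ i → lam (i + 1) = lam' i)
    (hm1 : ∀ i < i₀, mu i = mu' i + 1) (hm2 : mu i₀ = e) (hm3 : ∀ i, i₀ ≤ i → mu (i + 1) = mu' i)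
    (hle : ∀ i, i₀ ≤ i → lam' i ≤ e) (hge : ∀ i < i₀, e ≤ mu' i)
    (hk : k = 0 ∨ nu' k < nu' (k - 1)) (hnu : ∀ l, nu l = nu' l + if l = k then 1 else 0) :
    HasPattern (R + 1) lam mu nu := by
  obtain ⟨t, ht⟩ := h
  -- The partitions `t 0, …, t R` interlace, and `t i` is to receive a box in row `κ i`. Going from
  -- `t (i + 1)` to `t i`, the row number is kept if the interlacing inequality leaves room, and
  -- drops by one if that inequality is tight.
  obtain ⟨κ, hκR, hκ⟩ : ∃ κ : ℕ → ℕ, κ R = k ∧ ∀ i < R,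
      (κ i = κ (i + 1) ∧ (κ (i + 1) = 0 ∨ t (i + 1) (κ (i + 1)) < t i (κ (i + 1) - 1))) ∨
      (κ i + 1 = κ (i + 1) ∧ t (i + 1) (κ i + 1) = t i (κ i)) := by
    set g : ℕ → ℕ := slideIndex t R k with hgdef
    refine ⟨fun i => g (R - i), by simp [g, slideIndex], fun i hi => ?_⟩
    obtain ⟨d, hd⟩ : ∃ d, R = i + d + 1 := ⟨R - i - 1, by omega⟩
    have e1 : R - i = d + 1 := by omega
    have e2 : R - (i + 1) = d := by omega
    have e3 : R - d = i + 1 := by omega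
    simp only [e1, e2]
    have hg : g (d + 1) =
        if g d = 0 ∨ t (i + 1) (g d) < t i (g d - 1) then g d else g d - 1 := by
      rw [hgdef, slideIndex, e3, Nat.add_sub_cancel]
    rw [hg]
    split_ifs with hc
    · exact Or.inl ⟨rfl, hc⟩
    · push Not at hc
      have h1 : g d - 1 + 1 = g d := by omega
      have h2 := ht.inter i hi (g d - 1)
      rw [h1] at h2 ⊢
      exact Or.inr ⟨rfl, le_antisymm h2 hc.2⟩
  have hstep : ∀ i < R, κ i = κ (i + 1) ∨ κ i + 1 = κ (i + 1) := fun i hi =>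
    (hκ i hi).imp And.left And.left
  -- Addability of the box is inherited from `t (i + 1)` to `t i`, starting from `hk` at `t R`.
  have hadd : ∀ d i, i + d = R → κ i = 0 ∨ t i (κ i) < t i (κ i - 1) := by
    intro d
    induction d with
    | zero =>
      rintro i rfl
      rw [Nat.add_zero] at hκR ht
      rw [hκR, ht.final, ht.final]
      exact hk
    | succ d ih =>
      intro i hi
      have h1 := ih (i + 1) (by omega)
      rcases hκ i (by omega) with ⟨h2, h3⟩ | ⟨h2, h3⟩
      · rw [← h2] at h3
        have := ht.mono i (by omega) (κ i)
        omega
      · rw [← h2] at h1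
        rcases Nat.eq_zero_or_pos (κ i) with h4 | h4
        · exact Or.inl h4
        · have := ht.inter i (by omega) (κ i - 1)
          rw [Nat.sub_add_cancel h4] at this
          simp only [Nat.add_sub_cancel] at h1
          omega
  have hadd' : ∀ i ≤ R, κ i = 0 ∨ t i (κ i) < t i (κ i - 1) := fun i hi =>
    hadd (R - i) i (by omega)
  have hκle : ∀ i ≤ R, κ i ≤ i := by
    intro i hi
    by_contra! hc
    have h1 := ht.eq_zero_of_le hi (κ i - 1) (by omega)
    have := hadd' i hi
    omega
  have hanti : ∀ i ≤ R, ∀ l, t i (l + 1) ≤ t i l := by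
    intro i hi l
    rcases Nat.eq_zero_or_pos i with rfl | h0
    · simp [ht.zero]
    · obtain ⟨i', rfl⟩ : ∃ i', i = i' + 1 := ⟨i - 1, by omega⟩
      exact (ht.inter i' (by omega) l).trans (ht.mono i' (by omega) l)
  have hs : ∀ j, i₀ ≤ j → ¬ j + 1 ≤ i₀ := fun j hj => by omega
  -- The rows above the isolated box keep their entries, the box receives the letter `κ i₀ + 1`, and
  -- each later row comes from the old row one place higher, corrected by the slide.
  refine ⟨fun j l => if j ≤ i₀ then t j l else t (j - 1) l + if l = κ (j - 1) then 1 else 0,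
    fun l => ?_, fun i hi l => ?_, fun i hi l => ?_, fun i hi => ?_, fun i hi l => ?_, fun l => ?_⟩
  · simp [ht.zero]
  · rcases lt_trichotomy i i₀ with h1 | rfl | h1
    · simp only [h1.le, show i + 1 ≤ i₀ from h1, if_true]
      exact ht.mono i (by omega) l
    · simp
    · obtain ⟨i', rfl⟩ : ∃ i', i = i' + 1 := ⟨i - 1, by omega⟩
      simp only [hs i' (by omega), hs (i' + 1) (by omega), if_false, Nat.add_sub_cancel]
      have h2 := ht.mono i' (by omega) l
      rcases hκ i' (by omega) with ⟨h3, h4⟩ | ⟨h3, h4⟩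
      · rw [h3]; omega
      · have h5 := hadd' (i' + 1) (by omega)
        rw [← h3] at h5 ⊢
        by_cases hl : l = κ i'
        · subst hl
          simp only [Nat.add_sub_cancel] at h5
          split_ifs <;> omega
        · rw [if_neg hl]; omega
  · rcases lt_trichotomy i i₀ with h1 | rfl | h1
    · simp only [h1.le, show i + 1 ≤ i₀ from h1, if_true]
      exact ht.inter i (by omega) l
    · simp only [hs i le_rfl, if_false, le_refl, if_true, Nat.add_sub_cancel]
      have h2 := hanti i (by omega) l
      have h3 := hadd' i (by omega)
      by_cases hl : l + 1 = κ i
      · rw [← hl] at h3 ⊢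
        simp only [Nat.add_sub_cancel] at h3
        split_ifs <;> omega
      · rw [if_neg hl]; omega
    · obtain ⟨i', rfl⟩ : ∃ i', i = i' + 1 := ⟨i - 1, by omega⟩
      simp only [hs i' (by omega), hs (i' + 1) (by omega), if_false, Nat.add_sub_cancel]
      have h2 := ht.inter i' (by omega) l
      by_cases hl : l + 1 = κ (i' + 1)
      · rcases hκ i' (by omega) with ⟨h3, h4⟩ | ⟨h3, h4⟩
        · rw [← hl] at h4
          simp only [Nat.add_sub_cancel] at h4
          rw [if_pos hl]; omega
        · rw [if_pos hl, if_pos (by omega : l = κ i')]; omega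
      · rw [if_neg hl]; omega
  · rcases lt_trichotomy i i₀ with h1 | rfl | h1
    · simp only [h1.le, show i + 1 ≤ i₀ from h1, if_true, hm1 i h1, hl1 i h1]
      have := ht.row i (by omega)
      omega
    · simp only [hs i le_rfl, if_false, le_refl, if_true, Nat.add_sub_cancel, sum_add_indicator]
      rw [hm2, hl2, if_pos (by have := hκle i (by omega); omega)]
      omega
    · obtain ⟨i', rfl⟩ : ∃ i', i = i' + 1 := ⟨i - 1, by omega⟩
      simp only [hs i' (by omega), hs (i' + 1) (by omega), if_false, Nat.add_sub_cancel,
        sum_add_indicator]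
      rw [hm3 i' (by omega), hl3 i' (by omega), sum_range_succ, sum_range_succ (fun l => t i' l),
        ht.eq_zero_of_le (by omega : i' ≤ R) (i' + 1) (by omega),
        ht.eq_zero_of_le (by omega : i' + 1 ≤ R) (i' + 1) (by omega),
        if_pos (by have := hκle (i' + 1) (by omega); omega),
        if_pos (by have := hκle i' (by omega); omega)]
      have := ht.row i' (by omega)
      omega
  · have hmono : ∀ i < R, ∀ n, ∑ l ∈ range n, t i l ≤ ∑ l ∈ range n, t (i + 1) l :=
      fun i hi n => sum_le_sum fun l _ => ht.mono i hi l
    rcases lt_trichotomy i i₀ with h1 | rfl | h1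
    · rcases Nat.lt_or_ge (i + 1) i₀ with h2 | h2
      · simp only [h1.le, h2.le, show i + 2 ≤ i₀ from h2, if_true, hm1 i h1, hm1 _ h2]
        have := ht.ss i (by omega) l
        omega
      · obtain rfl : i₀ = i + 1 := by omega
        simp only [h1.le, le_refl, hs (i + 1) le_rfl, if_true, if_false, hm1 i h1, hm2,
          show i + 2 - 1 = i + 1 from rfl, sum_add_indicator]
        have h3 := hge i h1
        have h4 := hmono i (by omega) l
        have h5 : (if κ (i + 1) < l + 1 then 1 else 0) ≤ 1 := by split_ifs <;> omega
        omega
    · simp only [hs i le_rfl, show ¬ i + 2 ≤ i by omega, if_false, le_refl, if_true,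
        Nat.add_sub_cancel, show i + 2 - 1 = i + 1 from rfl, sum_add_indicator]
      rw [hm2, hm3 i le_rfl]
      have h2 := ht.shape_add (by omega : i < R) (l + 1)
      have h3 := ht.shape_le (by omega : i < R) (l + 1)
      have h4 := hle i le_rfl
      have h5 := hstep i (by omega)
      have h6 : (if κ (i + 1) < l + 1 then 1 else 0) ≤
          (if κ i < l + 1 then 1 else 0) := by split_ifs <;> omega
      omega
    · obtain ⟨i', rfl⟩ : ∃ i', i = i' + 1 := ⟨i - 1, by omega⟩
      simp only [hs i' (by omega), hs (i' + 1) (by omega), show ¬ i' + 1 + 2 ≤ i₀ by omega,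
        if_false, Nat.add_sub_cancel, show i' + 1 + 2 - 1 = i' + 2 from rfl, sum_add_indicator]
      rw [hm3 i' (by omega), hm3 (i' + 1) (by omega)]
      have h2 := ht.ss i' (by omega) l
      have h3 := hκ i' (by omega)
      have h4 : (κ (i' + 1) = κ (i' + 2) ∧
          (κ (i' + 2) = 0 ∨ t (i' + 2) (κ (i' + 2)) < t (i' + 1) (κ (i' + 2) - 1))) ∨
          (κ (i' + 1) + 1 = κ (i' + 2) ∧ t (i' + 2) (κ (i' + 1) + 1) = t (i' + 1) (κ (i' + 1))) :=
        hκ (i' + 1) (by omega)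
      -- Only here do the added indicators violate the column inequality, by one unit. The slide
      -- supplies that unit: one of the two interlacing relations involved is strict and the other
      -- is an equality, so the old inequality was strict.
      by_cases hc : κ i' + 1 = l ∧ κ (i' + 1) = l ∧ κ (i' + 2) = l
      · obtain ⟨c0, c1, c2⟩ := hc
        subst c0
        have h5 := ht.ss i' (by omega) (κ i')
        have a1 : t (i' + 2) (κ i' + 1) < t (i' + 1) (κ i') := by
          rcases h4 with ⟨_, h4⟩ | ⟨h4, _⟩
          · rw [c2] at h4; simpa using h4
          · omega
        have a2 : t (i' + 1) (κ i' + 1) = t i' (κ i') := by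
          rcases h3 with ⟨h3, _⟩ | ⟨_, h3⟩
          · omega
          · exact h3
        rw [c1, c2]
        rw [sum_range_succ (fun l => t (i' + 2) l) (κ i' + 1), sum_range_succ (fun l => t i' l),
          sum_range_succ (fun l => t (i' + 1) l) (κ i' + 1)]
        rw [sum_range_succ (fun l => t (i' + 1) l)] at h5 ⊢
        split_ifs <;> omega
      · have h3' := hstep i' (by omega)
        have h4' : κ (i' + 1) = κ (i' + 2) ∨ κ (i' + 1) + 1 = κ (i' + 2) := hstep (i' + 1) (by omega)
        have h5 : (if κ (i' + 2) < l + 1 then 1 else 0) + (if κ i' < l then 1 else 0) ≤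
            (if κ (i' + 1) < l then 1 else 0) + (if κ (i' + 1) < l + 1 then 1 else 0) := by
          split_ifs <;> omega
        omega
  · simp only [show ¬ R + 1 ≤ i₀ by omega, if_false, Nat.add_sub_cancel, hκR, ht.final, hnu]

end SkewChar

/-! ### Richness, and its behaviour under insertions into boundary paths. -/

namespace SkewChar

open Finset YoungDiagram

/-- All partitions of `n` occur, after a transformation that is compatible with intersections and
adds a constant to the size, among the components of `[lam / mu]`. -/
def Rich (n : ℕ) (lam mu : YoungDiagram) : Prop :=
  ∃ (Φ : YoungDiagram → YoungDiagram) (c : ℕ), (∀ a b, Φ (a ⊓ b) = Φ a ⊓ Φ b) ∧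
    (∀ a, (Φ a).card = a.card + c) ∧ ∀ a, a.card = n → Φ a ∈ components lam mu

/-- The empty partition is the only one of size `0`, so the union with any one component serves as
the map. -/
theorem rich_zero {lam mu : YoungDiagram} (h : mu ≤ lam) : Rich 0 lam mu := by
  obtain ⟨nu, hnu⟩ := components_nonempty h
  refine ⟨fun a => union a nu, nu.card, fun a b => union_inf a b nu, fun a => card_union a nu,
    fun a ha => ?_⟩
  have h0 : a = ⊥ := by
    ext c
    rw [Finset.card_eq_zero.1 ha, cells_bot]
  have h1 : union a nu = nu := by
    apply ext_colLen
    intro j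
    rw [h0, colLen_union, colLen_bot, Nat.zero_add]
  change union a nu ∈ _
  rw [h1]
  exact hnu

theorem Rich.union {n : ℕ} {lam mu lam' mu' : YoungDiagram} (h : Rich n lam mu) (h' : mu' ≤ lam') :
    Rich n (union lam lam') (union mu mu') := by
  obtain ⟨Φ, c, h1, h2, h3⟩ := h
  obtain ⟨nu, hnu⟩ := components_nonempty h'
  refine ⟨fun a => SkewChar.union (Φ a) nu, c + nu.card, fun a b => ?_, fun a => ?_, fun a ha =>
    components_union (h3 a ha) hnu⟩
  · dsimp only
    rw [h1, union_inf]
  · rw [card_union, h2, add_assoc]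

theorem Rich.add {n : ℕ} {lam mu lam' mu' : YoungDiagram} (h : Rich n lam mu) (h' : mu' ≤ lam') :
    Rich n (add lam lam') (add mu mu') := by
  obtain ⟨Φ, c, h1, h2, h3⟩ := h
  obtain ⟨nu, hnu⟩ := components_nonempty h'
  refine ⟨fun a => SkewChar.add (Φ a) nu, c + nu.card, fun a b => ?_, fun a => ?_, fun a ha =>
    components_add (h3 a ha) hnu⟩
  · dsimp only
    rw [h1, add_inf]
  · rw [card_add, h2, add_assoc]

theorem Rich.g_le {n : ℕ} {lam mu : YoungDiagram} (h : Rich n lam mu) :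
    g n ≤ (componentPairs lam mu).encard := by
  obtain ⟨Φ, c, h1, h2, h3⟩ := h
  -- If `Φ a = Φ b`, then `Φ (a ⊓ b) = Φ a`; comparing sizes, `a ⊓ b` is all of `a`.
  have hinj : Function.Injective Φ := by
    have key : ∀ a b, Φ a = Φ b → a ≤ b := by
      intro a b hab
      have e1 := h1 a b
      rw [hab, inf_idem] at e1
      have e2 := congrArg YoungDiagram.card e1
      rw [← hab, h2, h2] at e2
      have e3 : (a ⊓ b).cells = a.cells :=
        Finset.eq_of_subset_of_card_le (cells_subset_iff.2 inf_le_left)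
          (by change a.card ≤ (a ⊓ b).card; omega)
      rw [← cells_subset_iff, ← e3]
      exact cells_subset_iff.2 inf_le_right
    exact fun a b hab => le_antisymm (key a b hab) (key b a hab.symm)
  refine Set.encard_le_encard_of_injOn (f := Sym2.map Φ) ?_ (Sym2.map.injective hinj).injOn
  rintro _ ⟨a, b, rfl, ha, hb, hab⟩
  refine ⟨Φ a, Φ b, rfl, h3 a ha, h3 b hb, ?_⟩
  rw [DifferByOneBox, ← h1, h2, h2, h2]
  have h4 := hab.1
  have h5 := hab.2
  omega

/-- The row lengths of the diagram above a lattice path, read from its upper right end to its lower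
left end; `true` is a vertical step and `false` is a horizontal step. -/
def pathRow : List Bool → ℕ → ℕ
  | [], _ => 0
  | true :: l, 0 => l.count false
  | true :: l, i + 1 => pathRow l i
  | false :: l, i => pathRow l i

/-- The column lengths of the diagram above a lattice path. -/
def pathCol : List Bool → ℕ → ℕ
  | [], _ => 0
  | true :: l, j => pathCol l j + if j < l.count false then 1 else 0
  | false :: l, j => pathCol l j

theorem pathRow_le (l : List Bool) (i : ℕ) : pathRow l i ≤ l.count false := by
  induction l generalizing i with
  | nil => simp [pathRow]
  | cons a l ih =>
    cases a
    · simpa [pathRow] using (ih i).trans (Nat.le_succ _)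
    · cases i with
      | zero => simp [pathRow]
      | succ i => simpa [pathRow] using ih i

theorem pathRow_of_ge (l : List Bool) (i : ℕ) (h : l.count true ≤ i) : pathRow l i = 0 := by
  induction l generalizing i with
  | nil => rfl
  | cons a l ih =>
    cases a
    · exact ih i (by simpa using h)
    · rw [List.count_cons_self] at h
      obtain ⟨i, rfl⟩ : ∃ i', i = i' + 1 := ⟨i - 1, by omega⟩
      exact ih i (by omega)

theorem pathRow_anti (l : List Bool) : Antitone (pathRow l) := by
  refine antitone_nat_of_succ_le fun i => ?_
  induction l generalizing i with
  | nil => simp [pathRow]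
  | cons a l ih =>
    cases a
    · exact ih i
    · cases i with
      | zero => exact pathRow_le l 0
      | succ i => exact ih i

theorem lt_pathRow_iff (l : List Bool) (i j : ℕ) : j < pathRow l i ↔ i < pathCol l j := by
  induction l generalizing i with
  | nil => simp [pathRow, pathCol]
  | cons a l ih =>
    cases a
    · exact ih i
    · have h0 := ih 0
      have h1 := pathRow_le l 0
      cases i with
      | zero =>
        simp only [pathRow, pathCol]
        split_ifs <;> omega
      | succ i =>
        have h2 := ih i
        simp only [pathRow, pathCol]
        have h3 := pathRow_le l i
        split_ifs <;> omega

/-- The partition whose diagram lies above a lattice path. -/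
def pathShape (l : List Bool) : YoungDiagram := ofFun (pathRow l) (pathRow_anti l) (l.count true)

theorem rowLen_pathShape (l : List Bool) (i : ℕ) : (pathShape l).rowLen i = pathRow l i :=
  rowLen_ofFun _ (pathRow_of_ge l _ le_rfl) i

theorem colLen_pathShape (l : List Bool) (j : ℕ) : (pathShape l).colLen j = pathCol l j := by
  apply eq_of_forall_lt_iff
  intro i
  rw [← lt_rowLen_iff_lt_colLen, rowLen_pathShape, lt_pathRow_iff]

theorem pathRow_append (a b : List Bool) (i : ℕ) : pathRow (a ++ b) i =
    if i < a.count true then pathRow a i + b.count false else pathRow b (i - a.count true) := by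
  induction a generalizing i with
  | nil => simp
  | cons x a ih =>
    cases x
    · simpa [pathRow] using ih i
    · cases i with
      | zero => simp [pathRow]
      | succ i => simpa [pathRow] using ih i

theorem pathCol_insert_true (a b : List Bool) (j : ℕ) :
    pathCol (a ++ true :: b) j = pathCol (a ++ b) j + if j < b.count false then 1 else 0 := by
  induction a with
  | nil => rfl
  | cons x a ih =>
    cases x
    · exact ih
    · simp only [List.cons_append, pathCol, ih, List.count_append, List.count_cons_of_ne,
        ne_eq, Bool.true_eq_false, not_false_eq_true]
      omega

theorem pathRow_insert_false (a b : List Bool) (i : ℕ) :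
    pathRow (a ++ false :: b) i = pathRow (a ++ b) i + if i < a.count true then 1 else 0 := by
  rw [pathRow_append, pathRow_append]
  split_ifs
  · simp [Nat.add_assoc]
  · rfl

/-- A vertical step is a row, whose length is the number of horizontal steps still to come. -/
theorem pathShape_insert_true (a b : List Bool) :
    pathShape (a ++ true :: b) = union (pathShape (a ++ b)) (oneRow (b.count false)) := by
  apply ext_colLen
  intro j
  rw [colLen_union, colLen_pathShape, colLen_pathShape, pathCol_insert_true, colLen_oneRow]

theorem pathShape_insert_false (a b : List Bool) :
    pathShape (a ++ false :: b) =
      add (pathShape (a ++ b)) (oneRow (a.count true)).transpose := by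
  apply ext_rowLen
  intro i
  rw [rowLen_add, rowLen_pathShape, rowLen_pathShape, pathRow_insert_false, rowLen_transpose,
    colLen_oneRow]

theorem oneRow_mono {r s : ℕ} (h : r ≤ s) : oneRow r ≤ oneRow s :=
  le_iff_rowLen_le.2 fun i => by
    rw [rowLen_oneRow, rowLen_oneRow]
    split_ifs <;> omega

theorem Rich.insert_true {n : ℕ} {a b c d : List Bool}
    (h : Rich n (pathShape (a ++ b)) (pathShape (c ++ d))) (hle : d.count false ≤ b.count false) :
    Rich n (pathShape (a ++ true :: b)) (pathShape (c ++ true :: d)) := by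
  rw [pathShape_insert_true, pathShape_insert_true]
  exact h.union (oneRow_mono hle)

theorem Rich.insert_false {n : ℕ} {a b c d : List Bool}
    (h : Rich n (pathShape (a ++ b)) (pathShape (c ++ d))) (hle : c.count true ≤ a.count true) :
    Rich n (pathShape (a ++ false :: b)) (pathShape (c ++ false :: d)) := by
  rw [pathShape_insert_false, pathShape_insert_false]
  exact h.add (YoungDiagram.transpose_mono (oneRow_mono hle))

theorem exists_rowLen_eq_of_card {a b : YoungDiagram} (h : a ≤ b) (hc : b.card = a.card + 1) :
    ∃ k, (k = 0 ∨ a.rowLen k < a.rowLen (k - 1)) ∧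
      ∀ l, b.rowLen l = a.rowLen l + if l = k then 1 else 0 := by
  have h1 : (b.cells \ a.cells).card = 1 := by
    rw [card_sdiff_of_subset (cells_subset_iff.2 h)]
    change b.card - a.card = 1
    omega
  obtain ⟨⟨k, j⟩, hkj⟩ := card_eq_one.1 h1
  have hmem : ∀ i j', (j' < b.rowLen i ∧ ¬ j' < a.rowLen i) ↔ (i = k ∧ j' = j) := by
    intro i j'
    rw [← mem_iff_lt_rowLen, ← mem_iff_lt_rowLen, ← mem_cells, ← mem_cells, ← mem_sdiff, hkj,
      mem_singleton, Prod.mk.injEq]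
  have hle := le_iff_rowLen_le.1 h
  have hrow : ∀ l, b.rowLen l = a.rowLen l + if l = k then 1 else 0 := by
    intro l
    have h2 := hmem l (a.rowLen l)
    have h3 := hmem l (a.rowLen l + 1)
    have h4 := hmem k j
    have h5 := hle l
    split_ifs with hl
    · subst hl
      omega
    · omega
  refine ⟨k, ?_, hrow⟩
  rcases Nat.eq_zero_or_pos k with h0 | h0
  · exact Or.inl h0
  · right
    have h2 := hrow k
    have h3 := hrow (k - 1)
    have h4 := b.rowLen_anti (k - 1) k (by omega)
    rw [if_pos rfl] at h2
    rw [if_neg (by omega)] at h3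
    omega

theorem exists_le_card {a : YoungDiagram} {n : ℕ} (h : a.card = n + 1) : ∃ b ≤ a, b.card = n := by
  set y := a.colLen 0 with hy
  have hz : ∀ i, a.rowLen i = 0 ↔ y ≤ i := rowLen_eq_zero_iff a
  have hsum := card_eq_sum_rowLen a hy.ge
  have hy0 : 0 < y := by
    by_contra hc
    rw [show y = 0 by omega, range_zero, sum_empty] at hsum
    omega
  have hanti : Antitone fun i => a.rowLen i - if i + 1 = y then 1 else 0 := by
    refine antitone_nat_of_succ_le fun i => ?_
    have h1 := a.rowLen_anti i (i + 1) (by omega)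
    have h2 := hz (i + 1)
    split_ifs <;> omega
  have hrow := rowLen_ofFun hanti (N := y) (by simp [(hz y).2 le_rfl])
  refine ⟨ofFun _ hanti y, le_iff_rowLen_le.2 fun i => ?_, ?_⟩
  · rw [hrow]; omega
  · rw [card_eq_sum_rowLen (R := y) _ (by
      rw [← rowLen_eq_zero_iff, hrow]
      simp [(hz y).2 le_rfl])]
    simp only [hrow]
    obtain ⟨m, hm⟩ : ∃ m, y = m + 1 := ⟨y - 1, by omega⟩
    rw [hm, sum_range_succ] at hsum ⊢
    have h1 : ∑ i ∈ range m, (a.rowLen i - if i + 1 = m + 1 then 1 else 0) =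
        ∑ i ∈ range m, a.rowLen i := by
      refine sum_congr rfl fun i hi => ?_
      rw [if_neg (by have := mem_range.1 hi; omega), Nat.sub_zero]
    have h2 := hz m
    rw [h1, if_pos rfl]
    omega

/-- The map stays the same. A partition of `n + 1` contains one of `n`; the image of the smaller is
a component of the old diagram, the image of the larger has one box more, and the isolated box
supplies it. -/
theorem Rich.insert_box {n : ℕ} {a b c d : List Bool}
    (h : Rich n (pathShape (a ++ b)) (pathShape (c ++ d))) (ht : a.count true = c.count true)
    (hf : b.count false = d.count false) :
    Rich (n + 1) (pathShape (a ++ true :: false :: b)) (pathShape (c ++ false :: true :: d)) := by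
  obtain ⟨Φ, k, h1, h2, h3⟩ := h
  refine ⟨Φ, k, h1, h2, fun α hα => ?_⟩
  obtain ⟨β, hβ, hcard⟩ := exists_le_card hα
  have hmem := h3 β hcard
  have hle : Φ β ≤ Φ α := by
    rw [← inf_eq_left.2 hβ, h1]
    exact inf_le_right
  obtain ⟨l, hl, hrow⟩ := exists_rowLen_eq_of_card hle (by rw [h2, h2]; omega)
  have hsub := le_iff_rowLen_le.1 (le_of_mem_components hmem)
  set R := (a ++ b).count true with hR
  have hcol : (pathShape (a ++ b)).colLen 0 ≤ R := by
    rw [← rowLen_eq_zero_iff, rowLen_pathShape]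
    exact pathRow_of_ge _ _ le_rfl
  have hp := ((mem_components_iff hcol).1 hmem).2
  simp only [rowLen_pathShape] at hsub
  have E1 : ∀ i < c.count true, pathRow (a ++ true :: false :: b) i = pathRow (a ++ b) i + 1 := by
    intro i hi
    rw [pathRow_append, pathRow_append, if_pos (by omega), if_pos (by omega)]
    simp [Nat.add_assoc]
  have E2 : pathRow (a ++ true :: false :: b) (c.count true) = d.count false + 1 := by
    rw [pathRow_append, if_neg (by omega), ht, Nat.sub_self]
    simp [pathRow, hf]
  have E3 : ∀ i, c.count true ≤ i →
      pathRow (a ++ true :: false :: b) (i + 1) = pathRow (a ++ b) i := by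
    intro i hi
    rw [pathRow_append, pathRow_append, if_neg (by omega), if_neg (by omega), ht,
      Nat.sub_add_comm hi]
    rfl
  have F1 : ∀ i < c.count true, pathRow (c ++ false :: true :: d) i = pathRow (c ++ d) i + 1 := by
    intro i hi
    rw [pathRow_append, pathRow_append, if_pos hi, if_pos hi]
    simp [Nat.add_assoc]
  have F2 : pathRow (c ++ false :: true :: d) (c.count true) = d.count false := by
    rw [pathRow_append, if_neg (by omega), Nat.sub_self]
    simp [pathRow]
  have F3 : ∀ i, c.count true ≤ i →
      pathRow (c ++ false :: true :: d) (i + 1) = pathRow (c ++ d) i := by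
    intro i hi
    rw [pathRow_append, pathRow_append, if_neg (by omega), if_neg (by omega), Nat.sub_add_comm hi]
    rfl
  rw [mem_components_iff (R := R + 1)]
  · refine ⟨le_iff_rowLen_le.2 fun i => ?_, ?_⟩
    · rw [rowLen_pathShape, rowLen_pathShape]
      rcases lt_trichotomy i (c.count true) with hi | rfl | hi
      · rw [E1 i hi, F1 i hi]; exact Nat.succ_le_succ (hsub i)
      · rw [E2, F2]; omega
      · obtain ⟨i', rfl⟩ : ∃ i', i = i' + 1 := ⟨i - 1, by omega⟩
        rw [E3 i' (by omega), F3 i' (by omega)]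
        exact hsub i'
    · have := hp.insert_box (i₀ := c.count true) (e := d.count false) (k := l)
        (lam := pathRow (a ++ true :: false :: b)) (mu := pathRow (c ++ false :: true :: d))
        (nu := (Φ α).rowLen)
        (by rw [hR, List.count_append]; omega)
        (by simpa only [rowLen_pathShape] using E1) E2
        (by simpa only [rowLen_pathShape] using E3)
        (by simpa only [rowLen_pathShape] using F1) F2
        (by simpa only [rowLen_pathShape] using F3)
        (fun i hi => by
          rw [rowLen_pathShape, pathRow_append, if_neg (by omega), ← hf]
          exact pathRow_le _ _)
        (fun i hi => by
          rw [rowLen_pathShape, pathRow_append, if_pos hi]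
          omega)
        hl hrow
      exact this.congr (fun i _ => (rowLen_pathShape _ i).symm)
        (fun i _ => (rowLen_pathShape _ i).symm) fun i => rfl
  · rw [← rowLen_eq_zero_iff, rowLen_pathShape]
    refine pathRow_of_ge _ _ ?_
    rw [hR]
    simp only [List.count_append, List.count_cons_self, ne_eq, Bool.false_eq_true,
      not_false_eq_true, List.count_cons_of_ne]
    omega

end SkewChar

/-! ### Balanced pairs of lattice paths, their turns and their reductions. -/

namespace SkewChar

/-- `Bal h L M`: the lattice path `L`, started `h` units above the start of the lattice path `M` on
the same antidiagonal, ends where `M` ends, stays weakly above `M`, and the two paths never make a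
parallel step while they touch. -/
inductive Bal : ℕ → List Bool → List Bool → Prop
  | nil : Bal 0 [] []
  | up {h L M} : Bal (h + 1) L M → Bal h (true :: L) (false :: M)
  | down {h L M} : Bal h L M → Bal (h + 1) (false :: L) (true :: M)
  | level {h L M} (x : Bool) : Bal (h + 1) L M → Bal (h + 1) (x :: L) (x :: M)

/-- `Conn h L M`: the lattice path `L`, started `h + 1` units above the start of `M`, ends where `M`
ends, and touches `M` only there. -/
inductive Conn : ℕ → List Bool → List Bool → Prop
  | meet : Conn 0 [false] [true]
  | up {h L M} : Conn (h + 1) L M → Conn h (true :: L) (false :: M)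
  | down {h L M} : Conn h L M → Conn (h + 1) (false :: L) (true :: M)
  | level {h L M} (x : Bool) : Conn h L M → Conn h (x :: L) (x :: M)

theorem Bal.count {h : ℕ} {L M : List Bool} (H : Bal h L M) :
    M.count true = L.count true + h ∧ L.count false = M.count false + h := by
  induction H with
  | nil => simp
  | up _ ih => simp; omega
  | down _ ih => simp; omega
  | level x _ ih => cases x <;> simp <;> omega

theorem Conn.bal {h : ℕ} {L M : List Bool} (H : Conn h L M) : Bal (h + 1) L M := by
  induction H with
  | meet => exact .down .nil
  | up _ ih => exact .up ih
  | down _ ih => exact .down ih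
  | level x _ ih => exact .level x ih

theorem Conn.bal_append {h : ℕ} {L M L' M' : List Bool} (H : Conn h L M) (H' : Bal 0 L' M') :
    Bal (h + 1) (L ++ L') (M ++ M') := by
  induction H with
  | meet => exact .down H'
  | up _ ih => exact .up ih
  | down _ ih => exact .down ih
  | level x _ ih => exact .level x ih

theorem Bal.append {h : ℕ} {L M L' M' : List Bool} (H : Bal h L M) (H' : Bal 0 L' M') :
    Bal h (L ++ L') (M ++ M') := by
  induction H with
  | nil => exact H'
  | up _ ih => exact .up ih
  | down _ ih => exact .down ih
  | level x _ ih => exact .level x ih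

/-- Both paths are cut at the first point where they meet. -/
theorem Bal.exists_conn {h : ℕ} {L M : List Bool} (H : Bal (h + 1) L M) :
    ∃ l m L' M', L = l ++ L' ∧ M = m ++ M' ∧ Conn h l m ∧ Bal 0 L' M' := by
  generalize hk : h + 1 = k at H
  induction H generalizing h with
  | nil => omega
  | up _ ih =>
    subst hk
    obtain ⟨l, m, L', M', rfl, rfl, h1, h2⟩ := ih rfl
    exact ⟨_, _, L', M', rfl, rfl, h1.up, h2⟩
  | @down h' L M H ih =>
    obtain rfl : h = h' := by omega
    cases h with
    | zero => exact ⟨_, _, L, M, rfl, rfl, .meet, H⟩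
    | succ h =>
      obtain ⟨l, m, L', M', rfl, rfl, h1, h2⟩ := ih rfl
      exact ⟨_, _, L', M', rfl, rfl, h1.down, h2⟩
  | level x _ ih =>
    obtain ⟨l, m, L', M', rfl, rfl, h1, h2⟩ := ih hk
    exact ⟨_, _, L', M', rfl, rfl, h1.level x, h2⟩

/-- Reflection of a lattice path. -/
def flip (l : List Bool) : List Bool := l.map not

theorem flip_flip (l : List Bool) : flip (flip l) = l := by
  induction l with
  | nil => rfl
  | cons x l ih => exact congrArg₂ List.cons (Bool.not_not x) ih

theorem flip_append (a b : List Bool) : flip (a ++ b) = flip a ++ flip b := List.map_append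

theorem flip_cons (x : Bool) (a : List Bool) : flip (x :: a) = (!x) :: flip a := rfl

theorem count_flip (x : Bool) (l : List Bool) : (flip l).count x = l.count (!x) := by
  induction l with
  | nil => rfl
  | cons y l ih => cases x <;> cases y <;> simpa [flip_cons] using ih

theorem Bal.flip {h : ℕ} {L M : List Bool} (H : Bal h L M) :
    Bal h (SkewChar.flip M) (SkewChar.flip L) := by
  induction H with
  | nil => exact .nil
  | up _ ih => exact .up ih
  | down _ ih => exact .down ih
  | level x _ ih => exact .level _ ih

theorem Conn.flip {h : ℕ} {L M : List Bool} (H : Conn h L M) :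
    Conn h (SkewChar.flip M) (SkewChar.flip L) := by
  induction H with
  | meet => exact .meet
  | up _ ih => exact .up ih
  | down _ ih => exact .down ih
  | level x _ ih => exact .level _ ih

theorem Bal.pathRow_le {h : ℕ} {L M : List Bool} (H : Bal h L M) (i : ℕ) :
    pathRow M (i + h) ≤ pathRow L i := by
  induction H generalizing i with
  | nil => exact le_rfl
  | @up h L M H ih =>
    cases i with
    | zero =>
      have h1 := SkewChar.pathRow_le M h
      have h2 := H.count
      rw [Nat.zero_add, pathRow, pathRow]
      omega
    | succ i =>
      have h1 := ih i
      rwa [← Nat.add_assoc, Nat.add_right_comm] at h1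
  | down _ ih => exact ih i
  | @level h L M x H ih =>
    cases x with
    | false => exact ih i
    | true =>
      cases i with
      | zero =>
        have h1 := SkewChar.pathRow_le M h
        have h2 := H.count
        rw [Nat.zero_add, pathRow, pathRow]
        omega
      | succ i =>
        have h1 := ih i
        rwa [← Nat.add_assoc, Nat.add_right_comm] at h1

theorem Bal.pathShape_le {L M : List Bool} (H : Bal 0 L M) : pathShape M ≤ pathShape L :=
  le_iff_rowLen_le.2 fun i => by
    rw [rowLen_pathShape, rowLen_pathShape]
    exact H.pathRow_le i

/-- The number of turns `x`, `!x` of a lattice path. -/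
def turns (x : Bool) : List Bool → ℕ
  | [] => 0
  | y :: l => turns x l + if y = x ∧ l.head? = some (!x) then 1 else 0

theorem turns_le_cons (x y : Bool) (l : List Bool) : turns x l ≤ turns x (y :: l) :=
  Nat.le_add_right _ _

theorem turns_cons_le (x y : Bool) (l : List Bool) : turns x (y :: l) ≤ turns x l + 1 := by
  rw [turns]
  split_ifs <;> omega

theorem turns_cons_not (x : Bool) (l : List Bool) : turns x ((!x) :: l) = turns x l := by
  simp [turns]

theorem turns_dup (x y : Bool) (a b : List Bool) :
    turns x (a ++ y :: y :: b) = turns x (a ++ y :: b) := by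
  induction a with
  | nil => cases x <;> cases y <;> simp [turns]
  | cons z a ih => cases a <;> simp_all [turns]

theorem turns_cons_cons (x y z : Bool) (l : List Bool) :
    turns x (y :: z :: l) = turns x (z :: l) + if y = x ∧ z = !x then 1 else 0 := by
  simp [turns]

theorem turns_insert_pair (x : Bool) (a b : List Bool) :
    turns x (a ++ x :: (!x) :: b) ≤ turns x (a ++ b) + 1 := by
  induction a with
  | nil =>
    have h := turns_cons_le x x ((!x) :: b)
    rwa [turns_cons_not] at h
  | cons z a ih =>
    cases a with
    | nil =>
      by_cases hz : z = x
      · subst hz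
        have h1 := turns_dup z z [] ((!z) :: b)
        have h2 := turns_cons_le z z ((!z) :: b)
        have h3 := turns_le_cons z z b
        rw [turns_cons_not] at h2
        simp only [List.nil_append, List.cons_append] at h1 ⊢
        omega
      · obtain rfl : z = !x := by cases x <;> cases z <;> simp_all
        simpa only [List.cons_append, turns_cons_not] using ih
    | cons y a =>
      simp only [List.cons_append, turns_cons_cons x z] at ih ⊢
      omega

/-- No turn `x`, `!x` straddles the cut, because the letter before it is `!x`. -/
theorem turns_append (x : Bool) (a b : List Bool) :
    turns x (a ++ (!x) :: b) = turns x (a ++ [!x]) + turns x b := by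
  induction a with
  | nil => simp [turns]
  | cons z a ih =>
    cases a
    · simp only [List.cons_append, List.nil_append, turns_cons_cons, turns_cons_not]
      simp [turns, Nat.add_comm]
    · simp only [List.cons_append, turns_cons_cons x z] at ih ⊢
      omega

theorem turns_le_count (x : Bool) : ∀ l : List Bool, turns x l ≤ l.count (!x)
  | [] => le_rfl
  | [y] => by simp [turns]
  | y :: z :: l => by
    have h1 := turns_le_count x (z :: l)
    have h2 := turns_le_count x l
    rw [turns_cons_cons]
    split_ifs with h
    · obtain ⟨rfl, rfl⟩ := h
      rw [turns_cons_not]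
      simp only [List.count_cons_self, List.count_cons]
      omega
    · rw [List.count_cons]
      omega

/-- The word `l` has two equal neighbouring letters `x`. -/
def HasDouble (x : Bool) (l : List Bool) : Prop := ∃ a b, l = a ++ x :: x :: b

theorem HasDouble.cons {x : Bool} {l : List Bool} (h : HasDouble x l) (y : Bool) :
    HasDouble x (y :: l) := by
  obtain ⟨a, b, rfl⟩ := h
  exact ⟨y :: a, b, rfl⟩

/-- Without a doubled `x`, every `x` is followed by `!x`; the final letter makes this true of the
last `x` too. -/
theorem count_le_turns (x : Bool) : ∀ l : List Bool, ¬ HasDouble x (l ++ [!x]) →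
    (l ++ [!x]).count x ≤ turns x (l ++ [!x])
  | [], _ => by cases x <;> decide
  | [y], _ => by cases x <;> cases y <;> decide
  | y :: z :: l, h => by
    have h1 := count_le_turns x (z :: l) fun h' => h (h'.cons y)
    simp only [List.cons_append] at h h1 ⊢
    rw [turns_cons_cons, List.count_cons]
    by_cases hy : y = x
    · by_cases hz : z = x
      · exact absurd ⟨[], l ++ [!x], by rw [hy, hz]; rfl⟩ h
      · have hz' : z = !x := by cases x <;> cases z <;> simp_all
        rw [if_pos (show y = x ∧ z = !x from ⟨hy, hz'⟩), if_pos (by simp [hy])]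
        omega
    · simpa [hy] using h1

/-- Remove the same letter from two lattice paths, at places where this letter is doubled. -/
inductive Step : List Bool → List Bool → List Bool → List Bool → Prop
  | vert {a b c d} : d.count false ≤ b.count false →
    Step (a ++ true :: true :: b) (c ++ true :: true :: d) (a ++ true :: b) (c ++ true :: d)
  | horiz {a b c d} : c.count true ≤ a.count true →
    Step (a ++ false :: false :: b) (c ++ false :: false :: d) (a ++ false :: b) (c ++ false :: d)

/-- The pair of lattice paths `L`, `M` can be shortened without losing a turn. -/
def Reducible (L M : List Bool) : Prop := ∃ L' M', Step L M L' M' ∧ Bal 0 L' M'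

theorem Step.turns_eq {L M L' M' : List Bool} (H : Step L M L' M') (x : Bool) :
    turns x L = turns x L' ∧ turns x M = turns x M' := by
  cases H <;> exact ⟨turns_dup _ _ _ _, turns_dup _ _ _ _⟩

theorem Step.length {L M L' M' : List Bool} (H : Step L M L' M') : L'.length + 1 = L.length := by
  cases H <;> simp <;> omega

/-- The inequality in a step says that the row or column restored to `mu` is no longer than the one
restored to `lam`. -/
theorem Step.rich {n : ℕ} {L M L' M' : List Bool} (H : Step L M L' M')
    (h : Rich n (pathShape L') (pathShape M')) : Rich n (pathShape L) (pathShape M) := by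
  cases H with
  | vert hle => exact h.insert_true (by simpa using hle)
  | horiz hle => exact h.insert_false hle

theorem Reducible.append {L M A C : List Bool} (H : Reducible L M) (h : Bal 0 A C) :
    Reducible (L ++ A) (M ++ C) := by
  obtain ⟨L', M', h1, h2⟩ := H
  refine ⟨L' ++ A, M' ++ C, ?_, h2.append h⟩
  have h3 := h.count.2
  cases h1 <;> simp only [List.append_assoc, List.cons_append]
  · refine .vert ?_
    rw [List.count_append, List.count_append]
    omega
  · exact .horiz ‹_›

theorem Reducible.prepend {L M A C : List Bool} (H : Reducible L M) (h : Bal 0 A C) :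
    Reducible (A ++ L) (C ++ M) := by
  obtain ⟨L', M', h1, h2⟩ := H
  refine ⟨A ++ L', C ++ M', ?_, h.append h2⟩
  have h3 := h.count.1
  cases h1 <;> simp only [← List.append_assoc]
  · exact .vert ‹_›
  · refine .horiz ?_
    rw [List.count_append, List.count_append]
    omega

theorem Reducible.flip {L M : List Bool} (H : Reducible L M) :
    Reducible (SkewChar.flip M) (SkewChar.flip L) := by
  obtain ⟨L', M', h1, h2⟩ := H
  refine ⟨SkewChar.flip M', SkewChar.flip L', ?_, h2.flip⟩
  have h3 := h2.count
  cases h1 <;> simp only [flip_append, flip_cons, Bool.not_true, Bool.not_false]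
  · refine .horiz ?_
    simp only [count_flip, List.count_append, List.count_cons, Bool.not_true] at h3 ⊢
    simp at h3
    omega
  · refine .vert ?_
    simp only [count_flip, List.count_append, List.count_cons, Bool.not_false] at h3 ⊢
    simp at h3
    omega

end SkewChar

/-! ### Shortening a connected pair of paths. -/

namespace SkewChar

/-- The connected pair of lattice paths `L`, `M` stays connected when a suitable simultaneous doubled
step `x` of both paths is shortened. -/
def CommonDouble (x : Bool) (h : ℕ) (L M : List Bool) : Prop :=
  ∃ a b c d, L = a ++ x :: x :: b ∧ M = c ++ x :: x :: d ∧
    Conn h (a ++ x :: b) (c ++ x :: d) ∧ a.length = c.length ∧ c.count true ≤ a.count true + h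

theorem CommonDouble.cons {x y z : Bool} {h k : ℕ} {L M : List Bool} (H : CommonDouble x k L M)
    (hstep : ∀ l m, Conn k l m → Conn h (y :: l) (z :: m))
    (hk : [z].count true + k ≤ [y].count true + h) : CommonDouble x h (y :: L) (z :: M) := by
  obtain ⟨a, b, c, d, rfl, rfl, h1, h2, h3⟩ := H
  refine ⟨y :: a, b, z :: c, d, rfl, rfl, hstep _ _ h1, by simp [h2], ?_⟩
  rw [← List.singleton_append, List.count_append, ← List.singleton_append (l := a),
    List.count_append]
  omega

theorem CommonDouble.up {x : Bool} {h : ℕ} {L M : List Bool} (H : CommonDouble x (h + 1) L M) :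
    CommonDouble x h (true :: L) (false :: M) :=
  H.cons (fun _ _ => .up) (by simp)

theorem CommonDouble.down {x : Bool} {h : ℕ} {L M : List Bool} (H : CommonDouble x h L M) :
    CommonDouble x (h + 1) (false :: L) (true :: M) :=
  H.cons (fun _ _ => .down) (by simp; omega)

theorem CommonDouble.level {x : Bool} {h : ℕ} {L M : List Bool} (H : CommonDouble x h L M)
    (y : Bool) : CommonDouble x h (y :: L) (y :: M) :=
  H.cons (fun _ _ => .level y) le_rfl

theorem Conn.ne_nil_left {h : ℕ} {M : List Bool} (H : Conn h [] M) : False := by cases H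

theorem Conn.cons_cases {h : ℕ} {y z : Bool} {L M : List Bool} (H : Conn h (y :: L) (z :: M)) :
    L = [] ∨ (y = true ∧ z = false ∧ Conn (h + 1) L M) ∨
      (y = false ∧ z = true ∧ ∃ k, h = k + 1 ∧ Conn k L M) ∨ y = z ∧ Conn h L M := by
  cases H with
  | meet => exact .inl rfl
  | up H => exact .inr (.inl ⟨rfl, rfl, H⟩)
  | down H => exact .inr (.inr (.inl ⟨rfl, rfl, _, rfl, H⟩))
  | level _ H => exact .inr (.inr (.inr ⟨rfl, H⟩))

theorem Conn.length_eq {h : ℕ} {L M : List Bool} (H : Conn h L M) : L.length = M.length := by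
  induction H <;> simp_all

/-- At height `0` the lower path of a connected pair starts with `false` if the upper one does. -/
theorem Conn.zero_cases {L M : List Bool} (H : Conn 0 (false :: L) M) :
    (L = [] ∧ M = [true]) ∨ ∃ M', M = false :: M' ∧ Conn 0 L M' := by
  cases H with
  | meet => exact .inl ⟨rfl, rfl⟩
  | level _ H => exact .inr ⟨_, rfl, H⟩

/-- Dropping the first lower letter pairs each upper step with the next lower one. This fails to be
balanced only if the shifted paths touch and both step vertically; there the original paths have a
doubled vertical step at the same place, and shortening it keeps them connected. -/
theorem Conn.remove_last {h : ℕ} {c : Bool} {L M : List Bool}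
    (H : Conn h (L ++ [false]) (c :: M)) (hL : L = [] ∨ ∃ l, L = l ++ [false]) :
    Bal (h + [c].count false) L M ∨ CommonDouble true h (L ++ [false]) (c :: M) := by
  induction L generalizing h c M with
  | nil =>
    left
    cases H with
    | meet => exact .nil
    | down H => exact H.ne_nil_left.elim
    | level _ H => exact H.ne_nil_left.elim
  | cons d L ih =>
    have hL' : L = [] ∧ d = false ∨ ∃ l, L = l ++ [false] := by
      obtain h1 | ⟨l, hl⟩ := hL
      · cases h1
      · cases l with
        | nil => cases hl; exact .inl ⟨rfl, rfl⟩
        | cons _ l => cases hl; exact .inr ⟨l, rfl⟩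
    have hL'' := hL'.imp_left And.left
    cases M with
    | nil =>
      have := H.length_eq
      simp at this
    | cons z M =>
      rw [List.cons_append] at H
      rcases H.cons_cases with h0 | ⟨rfl, rfl, K⟩ | ⟨rfl, rfl, k, rfl, K⟩ | ⟨rfl, K⟩
      · simp at h0
      · rcases ih K hL'' with h1 | h1
        · left
          cases z with
          | false => exact .up h1
          | true => exact .level _ h1
        · exact .inr h1.up
      · rcases ih K hL'' with h1 | h1
        · left
          cases z with
          | false => exact .level _ h1
          | true => exact .down h1
        · exact .inr h1.down
      · rcases ih K hL'' with h1 | h1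
        · cases d with
          | false =>
            left
            cases z with
            | false => exact .level _ h1
            | true => exact .down h1
          | true =>
            cases z with
            | false => exact .inl (.up h1)
            | true =>
              cases h with
              | succ h => exact .inl (.level _ h1)
              | zero =>
                right
                cases L with
                | nil => simp at hL'
                | cons y L =>
                  rw [List.cons_append] at K
                  rcases K.cons_cases with h0 | ⟨-, h0, -⟩ | ⟨-, -, k, h0, -⟩ | ⟨rfl, K'⟩
                  · simp at h0
                  · cases h0
                  · cases h0
                  · exact ⟨[], L ++ [false], [], M, rfl, rfl, K'.level _, rfl, Nat.zero_le _⟩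
        · exact .inr (h1.level _)

/-- The shift begins at the doubled lower step only; the pairing before it is unchanged. -/
theorem Conn.remove_last_of_double {h : ℕ} {l u v : List Bool}
    (H : Conn h (l ++ [false, false]) (u ++ false :: false :: v)) :
    Bal (h + 1) (l ++ [false]) (u ++ false :: v) ∨
      CommonDouble true h (l ++ [false, false]) (u ++ false :: false :: v) := by
  induction u generalizing h l with
  | nil =>
    have := (show Conn h ((l ++ [false]) ++ [false]) (false :: false :: v) by
      simpa using H).remove_last (.inr ⟨l, rfl⟩)
    simpa using this
  | cons z u ih =>
    cases l with
    | nil =>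
      have := H.length_eq
      simp at this
      omega
    | cons y l =>
      rw [List.cons_append, List.cons_append] at H
      rcases H.cons_cases with h0 | ⟨rfl, rfl, K⟩ | ⟨rfl, rfl, k, rfl, K⟩ | ⟨rfl, K⟩
      · simp at h0
      · exact (ih K).imp .up .up
      · exact (ih K).imp .down .down
      · exact (ih K).imp (.level _) (·.level _)

theorem CommonDouble.reducible {x : Bool} {L M : List Bool} (H : CommonDouble x 0 L M) :
    Reducible (true :: L) (false :: M) := by
  obtain ⟨a, b, c, d, rfl, rfl, h1, h2, h3⟩ := H
  have h4 := h1.bal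
  refine ⟨true :: (a ++ x :: b), false :: (c ++ x :: d), ?_, h4.up⟩
  -- For a vertical double, the bound on the vertical steps before it has to become a bound on the
  -- horizontal steps after it. The prefixes have equal length, and the upper path has one
  -- horizontal step more in total.
  have h5 := h4.count.2
  have h6 := List.count_true_add_count_false a
  have h7 := List.count_true_add_count_false c
  rw [List.count_append, List.count_append, List.count_cons, List.count_cons] at h5
  cases x
  · exact .horiz (a := true :: a) (c := false :: c) (by simpa using h3.trans (Nat.le_succ _))
  · exact .vert (a := true :: a) (c := false :: c) (by omega)

/-- The doubled horizontal step at the end of the upper path is shortened together with the one in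
the lower path. If this destroys balance, a common doubled vertical step is available instead. -/
theorem Conn.reducible_of_horiz {l M : List Bool} (H : Conn 0 (l ++ [false, false]) M)
    (hM : HasDouble false (false :: M)) :
    Reducible (true :: (l ++ [false, false])) (false :: M) := by
  obtain ⟨u, v, hv⟩ := hM
  cases u with
  | nil =>
    cases hv
    have := (show Conn 0 ((l ++ [false]) ++ [false]) (false :: v) by
      simpa using H).remove_last (.inr ⟨l, rfl⟩)
    rcases this with h1 | h1
    · exact ⟨true :: (l ++ [false]), false :: v, .horiz (a := true :: l) (b := []) (c := [])
        (Nat.zero_le _), h1.up⟩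
    · exact CommonDouble.reducible (by simpa using h1)
  | cons y u =>
    cases hv
    rcases H.remove_last_of_double with h1 | h1
    · refine ⟨true :: (l ++ [false]), false :: (u ++ false :: v),
        .horiz (a := true :: l) (b := []) (c := false :: u) ?_, h1.up⟩
      have := H.bal.count.1
      simp at this
      simp
      omega
    · exact h1.reducible

theorem Conn.last {h : ℕ} {L M : List Bool} (H : Conn h L M) :
    (h = 0 ∧ L = [false] ∧ M = [true]) ∨ (∃ l, L = l ++ [false, false]) ∨
      ∃ m, M = m ++ [true, true] := by
  have lift : ∀ (x : Bool) (l : List Bool) (y : Bool), (∃ a, l = a ++ [y, y]) →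
      ∃ a, x :: l = a ++ [y, y] := by
    rintro x l y ⟨a, rfl⟩
    exact ⟨x :: a, rfl⟩
  induction H with
  | meet => exact .inl ⟨rfl, rfl, rfl⟩
  | up _ ih =>
    rcases ih with ⟨h0, -⟩ | ih | ih
    · omega
    · exact .inr (.inl (lift _ _ _ ih))
    · exact .inr (.inr (lift _ _ _ ih))
  | down _ ih =>
    rcases ih with ⟨-, rfl, rfl⟩ | ih | ih
    · exact .inr (.inl ⟨[], rfl⟩)
    · exact .inr (.inl (lift _ _ _ ih))
    · exact .inr (.inr (lift _ _ _ ih))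
  | level x _ ih =>
    rcases ih with ⟨-, rfl, rfl⟩ | ih | ih
    · cases x
      · exact .inr (.inl ⟨[], rfl⟩)
      · exact .inr (.inr ⟨[], rfl⟩)
    · exact .inr (.inl (lift _ _ _ ih))
    · exact .inr (.inr (lift _ _ _ ih))

/-- Replacing the meeting step by a parallel one fuses the piece with what follows it. -/
theorem Conn.replace_last {h : ℕ} {L M : List Bool} (H : Conn h L M) :
    ∃ l m, L = l ++ [false] ∧ M = m ++ [true] ∧
      ∀ x L' M', Bal 1 L' M' → Bal (h + 1) (l ++ x :: L') (m ++ x :: M') := by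
  induction H with
  | meet => exact ⟨[], [], rfl, rfl, fun x L' M' h' => .level x h'⟩
  | up _ ih =>
    obtain ⟨l, m, rfl, rfl, h1⟩ := ih
    exact ⟨_ :: l, _ :: m, rfl, rfl, fun x L' M' h' => .up (h1 x L' M' h')⟩
  | down _ ih =>
    obtain ⟨l, m, rfl, rfl, h1⟩ := ih
    exact ⟨_ :: l, _ :: m, rfl, rfl, fun x L' M' h' => .down (h1 x L' M' h')⟩
  | level y _ ih =>
    obtain ⟨l, m, rfl, rfl, h1⟩ := ih
    exact ⟨_ :: l, _ :: m, rfl, rfl, fun x L' M' h' => .level y (h1 x L' M' h')⟩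

end SkewChar

/-! ### Classification of balanced pairs and the main induction. -/

namespace SkewChar

/-- An isolated box can be removed from the pair of lattice paths `L`, `M`. -/
def HasBox (L M : List Bool) : Prop :=
  ∃ A B C D, L = A ++ true :: false :: B ∧ M = C ++ false :: true :: D ∧ Bal 0 A C ∧ Bal 0 B D

/-- The lower path turns more often than the upper one, and starts with `false`, `true`. -/
def LowerTurns (L M : List Bool) : Prop :=
  ∃ L' M', L = true :: true :: L' ∧ M = false :: true :: M' ∧ Bal 1 L' M' ∧
    turns true L < turns false M

/-- The upper path turns more often than the lower one, and starts with `true`, `false`. -/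
def UpperTurns (L M : List Bool) : Prop :=
  ∃ L' M', L = true :: false :: L' ∧ M = false :: false :: M' ∧ Bal 1 L' M' ∧
    turns false M < turns true L

theorem turns_flip (x : Bool) (l : List Bool) : turns x (flip l) = turns (!x) l := by
  induction l with
  | nil => rfl
  | cons y l ih =>
    cases l with
    | nil => cases x <;> cases y <;> rfl
    | cons z l =>
      rw [flip_cons] at ih
      rw [flip_cons, flip_cons, turns_cons_cons, turns_cons_cons, ih]
      cases x <;> cases y <;> cases z <;> rfl

theorem LowerTurns.flip {L M : List Bool} (H : LowerTurns L M) :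
    UpperTurns (SkewChar.flip M) (SkewChar.flip L) := by
  obtain ⟨L', M', rfl, rfl, h1, h2⟩ := H
  refine ⟨SkewChar.flip M', SkewChar.flip L', rfl, rfl, h1.flip, ?_⟩
  rwa [turns_flip, turns_flip]

theorem UpperTurns.flip {L M : List Bool} (H : UpperTurns L M) :
    LowerTurns (SkewChar.flip M) (SkewChar.flip L) := by
  obtain ⟨L', M', rfl, rfl, h1, h2⟩ := H
  refine ⟨SkewChar.flip M', SkewChar.flip L', rfl, rfl, h1.flip, ?_⟩
  rwa [turns_flip, turns_flip]

/-- A connected piece whose lower boundary is a staircase and whose upper boundary has doubled ends. -/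
def LowerStair (L M : List Bool) : Prop :=
  (∃ l, L = true :: (l ++ [false, false])) ∧ ¬ HasDouble false (false :: M)

theorem LowerStair.exists_level {L M : List Bool} (hs : LowerStair L M) (H : Conn 0 L M) :
    ∃ L' M', L = true :: L' ∧ M = true :: M' ∧ Conn 0 L' M' := by
  obtain ⟨⟨l, rfl⟩, h2⟩ := hs
  cases H with
  | up H => exact absurd ⟨[], _, rfl⟩ h2
  | level _ H => exact ⟨_, _, rfl, rfl, H⟩

/-- Both turn counts are compared with the number of columns. Each horizontal step of the staircase
is followed by a turn, so the lower path has at least that many; the upper path wastes the second of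
its two final horizontal steps. -/
theorem LowerStair.turns_lt {L M : List Bool} (hs : LowerStair L M) (H : Conn 0 L M) :
    turns true (true :: L) < turns false (false :: M) := by
  obtain ⟨⟨l, rfl⟩, h2⟩ := hs
  obtain ⟨-, m, -, rfl, -⟩ := H.replace_last
  have h1 := count_le_turns false (false :: m) h2
  have h3 := H.bal.up.count.2
  have h4 := turns_append true (true :: true :: l) [false]
  have h5 := turns_le_count true (true :: true :: l ++ [false])
  have h6 : turns true [false] = 0 := rfl
  simp only [List.cons_append, Bool.not_true, Bool.not_false] at h1 h3 h4 h5 ⊢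
  simp only [List.count_append, List.count_cons, List.count_nil] at h1 h3 h5
  simp at h1 h3 h5
  omega

theorem Conn.classify_of_last {l M : List Bool} (H : Conn 0 (l ++ [false, false]) M) :
    Reducible (true :: (l ++ [false, false])) (false :: M) ∨
      LowerStair (l ++ [false, false]) M := by
  by_cases h1 : HasDouble false (false :: M)
  · exact .inl (H.reducible_of_horiz h1)
  · right
    refine ⟨?_, h1⟩
    cases l with
    | nil =>
      rcases H.zero_cases with ⟨h2, -⟩ | ⟨M', rfl, -⟩
      · cases h2
      · exact absurd ⟨[], _, rfl⟩ h1
    | cons y l =>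
      cases y with
      | true => exact ⟨l, rfl⟩
      | false =>
        rcases H.zero_cases with ⟨h2, -⟩ | ⟨M', rfl, -⟩
        · simp at h2
        · exact absurd ⟨[], _, rfl⟩ h1

/-- A piece other than a single box has an upper path ending in two horizontal steps or a lower path
ending in two vertical ones; reflection exchanges the two cases. -/
theorem Conn.classify {L M : List Bool} (H : Conn 0 L M) :
    (L = [false] ∧ M = [true]) ∨ Reducible (true :: L) (false :: M) ∨ LowerStair L M ∨
      LowerStair (SkewChar.flip M) (SkewChar.flip L) := by
  rcases H.last with ⟨-, h1⟩ | ⟨l, rfl⟩ | ⟨m, rfl⟩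
  · exact .inl h1
  · rcases H.classify_of_last with h1 | h1
    · exact .inr (.inl h1)
    · exact .inr (.inr (.inl h1))
  · have h1 := H.flip
    rw [flip_append] at h1 ⊢
    rcases h1.classify_of_last with h2 | h2
    · have h3 := h2.flip
      exact .inr (.inl (by simpa [flip_append, flip_cons, flip_flip, show SkewChar.flip [] = [] from rfl] using h3))
    · exact .inr (.inr (.inr h2))

/-- The upper path has a doubled horizontal step just before the meeting point, the lower path one
just after it. Shortening both removes a column, fuses the pieces and loses no turn. -/
theorem LowerStair.reducible_append {l m L M : List Bool} (hs : LowerStair l m) (H : Conn 0 l m)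
    (h : UpperTurns L M) : Reducible (true :: l ++ L) (false :: m ++ M) := by
  obtain ⟨L', M', rfl, rfl, h1, -⟩ := h
  obtain ⟨⟨k, rfl⟩, -⟩ := hs
  obtain ⟨k', m', h2, rfl, h3⟩ := H.replace_last
  obtain rfl : k' = true :: (k ++ [false]) := by
    refine List.append_cancel_right (?_ : _ ++ [false] = _ ++ [false])
    rw [← h2]
    simp
  have h4 := (h3 true (false :: L') (false :: M') (h1.level false)).up
  have h5 := H.bal.count.1
  refine ⟨true :: true :: (k ++ false :: true :: false :: L'),
    (false :: (m' ++ [true])) ++ false :: M', ?_, by simpa using h4⟩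
  have := Step.horiz (a := true :: true :: k) (b := true :: false :: L')
    (c := false :: (m' ++ [true])) (d := M') (by simp at h5 ⊢; omega)
  simpa using this

/-- Turns are additive at the meeting point, so the surplus of the lower path survives. -/
theorem LowerStair.append {l m L M : List Bool} (hs : LowerStair l m) (H : Conn 0 l m)
    (h : L = [] ∧ M = [] ∨ Bal 0 L M ∧ LowerTurns L M) :
    LowerTurns (true :: l ++ L) (false :: m ++ M) := by
  have hlt := hs.turns_lt H
  have hb : Bal 0 L M := by
    rcases h with ⟨rfl, rfl⟩ | h
    · exact .nil
    · exact h.1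
  have hle : turns true L ≤ turns false M := by
    rcases h with ⟨rfl, rfl⟩ | ⟨-, L', M', -, -, -, h⟩
    · exact le_rfl
    · exact h.le
  obtain ⟨l', m', rfl, rfl, h1⟩ := hs.exists_level H
  refine ⟨l' ++ L, m' ++ M, rfl, rfl, h1.bal_append hb, ?_⟩
  obtain ⟨l'', m'', rfl, rfl, -⟩ := h1.replace_last
  have e1 := turns_append true (true :: true :: l'') L
  have e2 := turns_append false (false :: true :: m'') M
  simp only [List.cons_append, List.append_assoc, Bool.not_true, Bool.not_false,
    List.nil_append] at e1 e2 hlt ⊢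
  omega

/-- The first connected piece is split off. A box or a reduction in either part persists in the
whole; two parts with a surplus on the same path combine, and parts with opposite surpluses give a
reduction across the joint. -/
theorem Bal.classify {L M : List Bool} (H : Bal 0 L M) :
    (L = [] ∧ M = []) ∨ HasBox L M ∨ Reducible L M ∨ LowerTurns L M ∨ UpperTurns L M := by
  induction hn : L.length using Nat.strong_induction_on generalizing L M with
  | h n ih =>
  subst hn
  cases H with
  | nil => exact .inl ⟨rfl, rfl⟩
  | up H =>
  obtain ⟨l, m, L, M, rfl, rfl, h1, h2⟩ := H.exists_conn
  right
  have hlm : Bal 0 (true :: l) (false :: m) := h1.bal.up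
  rcases h1.classify with ⟨rfl, rfl⟩ | h3 | h3 | h3
  · exact .inl ⟨[], L, [], M, rfl, rfl, .nil, h2⟩
  · exact .inr (.inl (h3.append h2))
  all_goals rcases ih _ (by simp) h2 rfl with h4 | ⟨A, B, C, D, rfl, rfl, h5, h6⟩ | h4 | h4 | h4
  · exact .inr (.inr (.inl (h3.append h1 (.inl h4))))
  · exact .inl ⟨_, B, _, D, (List.append_assoc (true :: l) A _).symm,
      (List.append_assoc (false :: m) C _).symm, hlm.append h5, h6⟩
  · exact .inr (.inl (h4.prepend hlm))
  · exact .inr (.inr (.inl (h3.append h1 (.inr ⟨h2, h4⟩))))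
  · exact .inr (.inl (h3.reducible_append h1 h4))
  · obtain ⟨rfl, rfl⟩ := h4
    have := (h3.append h1.flip (.inl ⟨rfl, rfl⟩)).flip
    exact .inr (.inr (.inr (by simpa [flip_append, flip_cons, flip_flip] using this)))
  · exact .inl ⟨_, B, _, D, (List.append_assoc (true :: l) A _).symm,
      (List.append_assoc (false :: m) C _).symm, hlm.append h5, h6⟩
  · exact .inr (.inl (h4.prepend hlm))
  · have := (h3.reducible_append h1.flip h4.flip).flip
    exact .inr (.inl (by simpa [flip_append, flip_cons, flip_flip] using this))
  · have := (h3.append h1.flip (.inr ⟨h2.flip, h4.flip⟩)).flip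
    exact .inr (.inr (.inr (by simpa [flip_append, flip_cons, flip_flip] using this)))

theorem Bal.rich {L M : List Bool} (H : Bal 0 L M) {n : ℕ} (hL : n ≤ turns true L)
    (hM : n ≤ turns false M) : Rich n (pathShape L) (pathShape M) := by
  induction hk : L.length using Nat.strong_induction_on generalizing L M n with
  | h k ih =>
  subst hk
  cases n with
  | zero => exact rich_zero H.pathShape_le
  | succ n =>
  rcases H.classify with ⟨rfl, rfl⟩ | ⟨A, B, C, D, rfl, rfl, h1, h2⟩ | ⟨L', M', h1, h2⟩ |
    ⟨L', M', rfl, rfl, h1, h2⟩ | ⟨L', M', rfl, rfl, h1, h2⟩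
  · simp [turns] at hL
  · have h3 := turns_insert_pair true A B
    have h4 := turns_insert_pair false C D
    simp only [Bool.not_true, Bool.not_false] at h3 h4
    exact (ih (A ++ B).length (by simp) (h1.append h2) (by omega) (by omega)
      rfl).insert_box h1.count.1.symm h2.count.2
  · have h3 := h1.turns_eq
    have h4 := h1.length
    refine h1.rich (ih L'.length (by omega) h2 ?_ ?_ rfl)
    · rw [← (h3 true).1]; exact hL
    · rw [← (h3 false).2]; exact hM
  · have h3 := turns_dup true true [] L'
    have h4 := turns_cons_le false false (true :: M')
    have h5 := turns_le_cons false false M'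
    rw [show turns false (true :: M') = turns false M' from turns_cons_not false M'] at h4
    have h6 := ih (true :: L').length (by simp) h1.up (n := n + 1)
      (by simp only [List.nil_append] at h3; omega) (by omega) rfl
    refine h6.insert_true (a := [true]) (c := [false]) ?_
    have := h1.count.2
    omega
  · have h3 := turns_dup false false [] M'
    have h4 := turns_cons_le true true (false :: L')
    have h5 := turns_le_cons true true L'
    rw [show turns true (false :: L') = turns true L' from turns_cons_not true L'] at h4
    have h6 := ih (true :: L').length (by simp) h1.up (n := n + 1)
      (by omega) (by simp only [List.nil_append] at h3; omega) rfl
    exact h6.insert_false (a := [true]) (c := [false]) (by simp)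

end SkewChar

/-! ### From basic skew diagrams to balanced pairs. -/

namespace SkewChar

open YoungDiagram

theorem exists_pathRow_eq (f : ℕ → ℕ) (hf : Antitone f) (x y : ℕ) (hx : f 0 ≤ x) (hy : f y = 0) :
    ∃ l : List Bool, l.count false = x ∧ l.count true = y ∧ ∀ i, pathRow l i = f i := by
  have hrep : ∀ k l i, pathRow (List.replicate k false ++ l) i = pathRow l i := by
    intro k l i
    rw [pathRow_append]
    simp [List.count_replicate]
  induction y generalizing f x with
  | zero =>
    refine ⟨List.replicate x false ++ [], by simp, by simp [List.count_replicate], fun i => ?_⟩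
    have := hf (Nat.zero_le i)
    rw [hrep, pathRow]
    omega
  | succ y ih =>
    obtain ⟨l, h1, h2, h3⟩ := ih (fun i => f (i + 1))
      (fun i j hij => hf (Nat.succ_le_succ hij)) (f 0) (hf (Nat.zero_le 1)) hy
    refine ⟨List.replicate (x - f 0) false ++ true :: l, ?_, ?_, fun i => ?_⟩
    · simp [h1]
      omega
    · simp [h2, List.count_replicate]
    · rw [hrep]
      cases i with
      | zero => exact h1
      | succ i => exact h3 i

/-- The induction follows the upper path, with `h` the current distance; `h1` excludes empty rows
and `h2` empty columns. At the start of the remaining path, `h3` compares the row already left by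
the upper path but not by the lower one, and `h4` forbids a horizontal upper step where the paths
touch. -/
theorem bal_of_pathRow {h : ℕ} {L M : List Bool} (ht : M.count true = L.count true + h)
    (hf : L.count false = M.count false + h)
    (h1 : ∀ i < L.count true, pathRow M (i + h) < pathRow L i)
    (h2 : ∀ i, pathRow M (i + h) ≤ pathRow L (i + 1))
    (h3 : ∀ k, h = k + 1 → pathRow M k ≤ pathRow L 0)
    (h4 : h = 0 → L.count false ≤ pathRow L 0) : Bal h L M := by
  induction L generalizing h M with
  | nil =>
    simp only [List.count_nil] at ht hf
    have h0 := List.count_true_add_count_false M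
    obtain rfl : h = 0 := by omega
    obtain rfl : M = [] := List.length_eq_zero_iff.1 (by omega)
    exact .nil
  | cons x L ih =>
    have e : ∀ i, i + 1 + h = i + (h + 1) := fun i => by omega
    have e' : ∀ i, i + (h + 1) = i + h + 1 := fun i => by omega
    cases x with
    | true =>
      cases M with
      | nil => simp at ht; omega
      | cons z M =>
        simp only [List.count_cons_self] at ht h1
        cases z with
        | false =>
          simp at ht hf
          refine .up (ih (by omega) (by omega) (fun i hi => ?_) (fun i => ?_) (fun k hk => ?_)
            (by omega))
          · have := h1 (i + 1) (by omega)
            rwa [e] at this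
          · have := h2 (i + 1)
            rwa [e] at this
          · obtain rfl : h = k := by omega
            have := h2 0
            rwa [Nat.zero_add] at this
        | true =>
          simp at ht hf
          cases h with
          | zero =>
            have := h1 0 (by omega)
            simp only [pathRow] at this
            omega
          | succ k =>
            refine .level _ (ih (by omega) (by omega) (fun i hi => ?_) (fun i => ?_)
              (fun k' hk => ?_) (by omega))
            · have := h1 (i + 1) (by omega)
              rwa [e] at this
            · have := h2 (i + 1)
              rwa [e] at this
            · obtain rfl : k = k' := by omega
              have := h2 0
              rwa [Nat.zero_add] at this
    | false =>
      cases h with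
      | zero =>
        have h5 := h4 rfl
        have h6 : pathRow (false :: L) 0 ≤ L.count false := pathRow_le L 0
        rw [List.count_cons_self] at h5
        omega
      | succ k =>
        cases M with
        | nil => simp at ht
        | cons z M =>
          have h1' : ∀ i < L.count true, pathRow (z :: M) (i + (k + 1)) < pathRow L i := fun i hi =>
            h1 i (by simpa using hi)
          cases z with
          | false =>
            simp at ht hf
            exact .level _ (ih (by omega) (by omega) h1' h2 h3 (by omega))
          | true =>
            simp at ht hf
            refine .down (ih (by omega) (by omega) h1' h2 (fun k' hk => ?_) fun hk => ?_)
            · subst hk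
              exact h3 _ rfl
            · subst hk
              have := h3 0 rfl
              simp only [pathRow] at this
              omega

theorem IsBasic.exists_bal {lam mu : YoungDiagram} (h : IsBasic lam mu) :
    ∃ L M, Bal 0 L M ∧ pathShape L = lam ∧ pathShape M = mu := by
  have hle := le_iff_rowLen_le.1 h.1
  have hy : lam.rowLen (lam.colLen 0) = 0 := (rowLen_eq_zero_iff _ _).2 le_rfl
  obtain ⟨L, h1, h2, h3⟩ := exists_pathRow_eq lam.rowLen (fun i j => lam.rowLen_anti i j)
    (lam.rowLen 0) (lam.colLen 0) le_rfl hy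
  obtain ⟨M, h4, h5, h6⟩ := exists_pathRow_eq mu.rowLen (fun i j => mu.rowLen_anti i j)
    (lam.rowLen 0) (lam.colLen 0) (hle 0) (Nat.le_zero.1 ((hle _).trans hy.le))
  refine ⟨L, M, bal_of_pathRow (by omega) (by omega) (fun i hi => ?_) (fun i => ?_)
    (by omega) (fun _ => ?_), ?_, ?_⟩
  · rw [Nat.add_zero, h3, h6]
    exact (h.2 i (by omega)).1
  · rw [Nat.add_zero, h3, h6]
    by_cases hi : i < lam.colLen 0
    · exact (h.2 i hi).2
    · have h7 := (rowLen_eq_zero_iff lam i).2 (by omega)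
      have h8 := hle i
      omega
  · rw [h3, h1]
  · exact ext_rowLen fun i => by rw [rowLen_pathShape, h3]
  · exact ext_rowLen fun i => by rw [rowLen_pathShape, h6]

/-- Consecutive vertical steps give equal rows, and a final vertical step gives an empty one, so a
new positive row length needs a turn. -/
theorem encard_pathRow_le (l : List Bool) :
    {v | 0 < v ∧ ∃ i, pathRow l i = v}.encard ≤ turns true l := by
  induction l with
  | nil =>
    rw [show {v | 0 < v ∧ ∃ i, pathRow [] i = v} = ∅ from Set.eq_empty_of_forall_notMem
      fun v ⟨h1, i, h2⟩ => h1.ne h2]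
    simp
  | cons x l ih =>
    cases x with
    | false =>
      rw [show turns true (false :: l) = turns true l from turns_cons_not true l]
      exact ih
    | true =>
      cases l with
      | nil =>
        refine (Set.encard_le_encard ?_).trans (ih.trans (by simp [turns]))
        rintro v ⟨h1, i, rfl⟩
        cases i with
        | zero => simp [pathRow] at h1
        | succ i => exact ⟨h1, i, rfl⟩
      | cons y l =>
        cases y with
        | true =>
          refine (Set.encard_le_encard ?_).trans (ih.trans (by simp [turns]))
          rintro v ⟨h1, i, rfl⟩
          cases i with
          | zero => exact ⟨h1, 0, by simp [pathRow]⟩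
          | succ i => exact ⟨h1, i, rfl⟩
        | false =>
          have hsub : {v | 0 < v ∧ ∃ i, pathRow (true :: false :: l) i = v} ⊆
              insert ((false :: l).count false) {v | 0 < v ∧ ∃ i, pathRow (false :: l) i = v} := by
            rintro v ⟨h1, i, rfl⟩
            cases i with
            | zero => exact Set.mem_insert _ _
            | succ i => exact Set.mem_insert_of_mem _ ⟨h1, i, rfl⟩
          refine (Set.encard_le_encard hsub).trans ((Set.encard_insert_le _ _).trans ?_)
          rw [turns_cons_cons]
          push_cast
          exact add_le_add ih (by simp)

theorem dp_pathShape_le (l : List Bool) : dp (pathShape l) ≤ turns true l := by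
  have h1 : ((pathShape l).rowLens.toFinset : Set ℕ) ⊆ {v | 0 < v ∧ ∃ i, pathRow l i = v} := by
    intro v hv
    rw [Finset.mem_coe, List.mem_toFinset] at hv
    refine ⟨YoungDiagram.pos_of_mem_rowLens _ v hv, ?_⟩
    obtain ⟨i, -, rfl⟩ := List.mem_map.1 hv
    exact ⟨i, (rowLen_pathShape l i).symm⟩
  have h2 := (Set.encard_le_encard h1).trans (encard_pathRow_le l)
  rw [Set.encard_coe_eq_coe_finsetCard] at h2
  exact_mod_cast h2

/-- The two kinds of turns alternate; as the last letter is fixed, only the first letter decides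
whether the counts agree. -/
theorem turns_true_concat : ∀ l : List Bool,
    turns true (l ++ [true]) + (if (l ++ [true]).head? = some false then 1 else 0) =
      turns false (l ++ [true])
  | [] => rfl
  | [y] => by cases y <;> rfl
  | y :: z :: l => by
    have h := turns_true_concat (z :: l)
    simp only [List.cons_append, turns_cons_cons, List.head?_cons] at h ⊢
    cases y <;> cases z <;> simp at h ⊢ <;> omega

theorem Bal.last {h : ℕ} {L M : List Bool} (H : Bal h L M) : M = [] ∨ ∃ m, M = m ++ [true] := by
  induction H with
  | nil => exact .inl rfl
  | up H ih =>
    rcases ih with rfl | ⟨m, rfl⟩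
    · have := H.count.1
      simp at this
    · exact .inr ⟨_ :: m, rfl⟩
  | down H ih =>
    rcases ih with rfl | ⟨m, rfl⟩
    · exact .inr ⟨[], rfl⟩
    · exact .inr ⟨_ :: m, rfl⟩
  | level x H ih =>
    rcases ih with rfl | ⟨m, rfl⟩
    · have := H.count.1
      simp at this
    · exact .inr ⟨_ :: m, rfl⟩

theorem Bal.turns_eq {L M : List Bool} (H : Bal 0 L M) (hL : L ≠ []) :
    turns true M + 1 = turns false M := by
  cases H with
  | nil => exact absurd rfl hL
  | @up _ L M H =>
    rcases H.up.last with h | ⟨m, h⟩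
    · cases h
    · rw [h, ← turns_true_concat m, ← h]
      rfl

theorem IsBasic.rich {lam mu : YoungDiagram} (h : IsBasic lam mu) : Rich (delta lam mu) lam mu := by
  obtain ⟨L, M, H, rfl, rfl⟩ := h.exists_bal
  have h1 := dp_pathShape_le L
  have h2 := dp_pathShape_le M
  by_cases hL : L = []
  · subst hL
    have h3 : delta (pathShape []) (pathShape M) = 0 :=
      Nat.le_zero.1 ((min_le_right _ _).trans h1)
    rw [h3]
    exact rich_zero h.1
  · have h3 := H.turns_eq hL
    exact H.rich ((min_le_right _ _).trans h1) ((min_le_left _ _).trans (by omega))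

end SkewChar

/-! ### Pairs of components from the ends and the middle rows. -/

namespace SkewChar

open YoungDiagram

theorem lt_countP_iff (w : List ℕ) (hw : w.Pairwise (· ≥ ·)) (i j : ℕ) :
    i < w.countP (j < ·) ↔ ∃ h : i < w.length, j < w[i] := by
  induction w generalizing i with
  | nil => simp
  | cons x w ih =>
    rw [List.pairwise_cons] at hw
    have ih := fun i => ih hw.2 i
    rw [List.countP_cons]
    by_cases hx : j < x
    · cases i with
      | zero => simp [hx]
      | succ i => simpa [hx] using ih i
    · have h0 : ∀ k, ¬ k < w.countP (j < ·) := fun k hk => by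
        obtain ⟨h1, h2⟩ := (ih k).1 hk
        have h3 := hw.1 _ (List.getElem_mem h1)
        omega
      have h1 := h0 i
      cases i with
      | zero => simpa [hx] using h1
      | succ i =>
        have h2 := (ih i).not.1 (h0 i)
        simp only [hx, decide_false, Bool.false_eq_true, if_false, Nat.add_zero]
        refine iff_of_false h1 ?_
        rintro ⟨h3, h4⟩
        exact h2 ⟨Nat.lt_of_succ_lt_succ h3, h4⟩

theorem colLen_ofRowLens (w : List ℕ) (hw : w.SortedGE) (j : ℕ) :
    (ofRowLens w hw).colLen j = w.countP (j < ·) := by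
  apply eq_of_forall_lt_iff
  intro i
  rw [lt_countP_iff w hw.pairwise, ← mem_iff_lt_colLen, mem_ofRowLens]

/-- Column lengths do not see the order of the parts, so the sorting in `ofParts` drops out and
identities between unions become counts. -/
theorem colLen_ofParts (w : List ℕ) (j : ℕ) : (ofParts w).colLen j = w.countP (j < ·) := by
  rw [ofParts, colLen_ofRowLens]
  exact (Multiset.coe_eq_coe.1 (Multiset.sort_eq (w : Multiset ℕ) (· ≥ ·))).countP_eq _

theorem colLen_eq_countP (a : YoungDiagram) (j : ℕ) : a.colLen j = a.rowLens.countP (j < ·) := by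
  rw [← colLen_ofRowLens _ (rowLens_sorted a), ofRowLens_to_rowLens_eq_self]

theorem rowLen_ofParts_pair {x y : ℕ} (h : y ≤ x) (i : ℕ) :
    (ofParts [x, y]).rowLen i = if i = 0 then x else if i = 1 then y else 0 := by
  apply eq_of_forall_lt_iff
  intro j
  rw [lt_rowLen_iff_lt_colLen, colLen_ofParts]
  simp only [List.countP_cons, List.countP_nil, decide_eq_true_eq]
  split_ifs <;> omega

theorem rowLen_ofParts_singleton (x i : ℕ) :
    (ofParts [x]).rowLen i = if i = 0 then x else 0 := by
  apply eq_of_forall_lt_iff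
  intro j
  rw [lt_rowLen_iff_lt_colLen, colLen_ofParts]
  simp only [List.countP_cons, List.countP_nil, decide_eq_true_eq]
  split_ifs <;> omega

theorem shape_add_comm (a b : YoungDiagram) : add a b = add b a :=
  ext_rowLen fun i => by rw [rowLen_add, rowLen_add, Nat.add_comm]

theorem inf_eq_of_sym2_eq {a b c d : YoungDiagram} (h : s(a, b) = s(c, d)) : a ⊓ b = c ⊓ d := by
  rcases Sym2.eq_iff.1 h with ⟨rfl, rfl⟩ | ⟨rfl, rfl⟩
  · rfl
  · exact inf_comm _ _

/-- If two components of `[C / C']` differ by one box, then adding components of `[A / A']` to them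
and taking the union with components of `[B / B']` yields many such pairs. -/
theorem max_encard_le_encard_componentPairs {A A' B B' C C' d e : YoungDiagram} (hA : A' ≤ A)
    (hB : B' ≤ B) (hd : d ∈ components C C') (he : e ∈ components C C') (hde : DifferByOneBox d e) :
    max (components A A').encard (components B B').encard ≤
      (componentPairs (union (add A C) B) (union (add A' C') B')).encard := by
  have hmem : ∀ {α β}, α ∈ components A A' → β ∈ components B B' →
      s(union (add α d) β, union (add α e) β) ∈
        componentPairs (union (add A C) B) (union (add A' C') B') := by
    intro α β hα hβ
    refine ⟨_, _, rfl, components_union (components_add hα hd) hβ,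
      components_union (components_add hα he) hβ, ?_⟩
    rw [DifferByOneBox, ← union_inf, shape_add_comm α d, shape_add_comm α e, ← add_inf]
    simp only [card_union, card_add]
    have h1 := hde.1
    have h2 := hde.2
    omega
  -- The intersection is an invariant of the unordered pair. Cancelling in it recovers `α` when `β`
  -- is fixed, and `β` when `α` is fixed.
  have hinf : ∀ α β : YoungDiagram, union (add α d) β ⊓ union (add α e) β =
      union (add (d ⊓ e) α) β := fun α β => by
    rw [← union_inf, shape_add_comm α d, shape_add_comm α e, ← add_inf]
  obtain ⟨α₀, hα₀⟩ := components_nonempty hA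
  obtain ⟨β₀, hβ₀⟩ := components_nonempty hB
  refine max_le ?_ ?_
  · refine Set.encard_le_encard_of_injOn (f := fun α => s(union (add α d) β₀, union (add α e) β₀))
      (fun α hα => hmem hα hβ₀) fun α _ α' _ h => ?_
    have h1 := inf_eq_of_sym2_eq h
    rw [hinf, hinf] at h1
    have h2 := union_right_cancel h1
    rw [shape_add_comm _ α, shape_add_comm _ α'] at h2
    exact add_right_cancel h2
  · refine Set.encard_le_encard_of_injOn (f := fun β => s(union (add α₀ d) β, union (add α₀ e) β))
      (fun β hβ => hmem hα₀ hβ) fun β _ β' _ h => ?_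
    have h1 := inf_eq_of_sym2_eq h
    rw [hinf, hinf, union_comm _ β, union_comm _ β'] at h1
    exact union_right_cancel h1

/-- The skew diagram `(2, 1) / (1)` has two components that differ by one box. -/
theorem exists_components_two_one :
    ∃ d e, d ∈ components (ofParts [2, 1]) (ofParts [1]) ∧
      e ∈ components (ofParts [2, 1]) (ofParts [1]) ∧ DifferByOneBox d e := by
  have H : Bal 0 [true, false, true, false] [false, true, false, true] :=
    .up (.down (.up (.down .nil)))
  -- The diagram consists of two isolated boxes, and the pair is the image of `(2)` and `(1, 1)`.
  obtain ⟨Φ, c, h1, h2, h3⟩ := H.rich (n := 2) (by decide) (by decide)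
  rw [show pathShape [true, false, true, false] = ofParts [2, 1] from ext_rowLen fun i => by
      rw [rowLen_pathShape, rowLen_ofParts_pair one_le_two]
      rcases i with _ | _ | i <;> rfl,
    show pathShape [false, true, false, true] = ofParts [1] from ext_rowLen fun i => by
      rw [rowLen_pathShape, rowLen_ofParts_singleton]
      rcases i with _ | _ | i <;> rfl] at h3
  have c1 : (ofParts [2]).card = 2 := by
    rw [card_eq_sum_rowLen (R := 2) _ (by rw [colLen_ofParts]; decide)]
    simp [rowLen_ofParts_singleton]
  have c2 : (ofParts [1, 1]).card = 2 := by
    rw [card_eq_sum_rowLen (R := 2) _ (by rw [colLen_ofParts]; decide)]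
    simp [Finset.sum_range_succ, rowLen_ofParts_pair]
  have c3 : (ofParts [2] ⊓ ofParts [1, 1]).card = 1 := by
    rw [card_eq_sum_rowLen (R := 2) _
      (by rw [colLen_inf, colLen_ofParts, colLen_ofParts]; decide)]
    simp [Finset.sum_range_succ, rowLen_inf, rowLen_ofParts_singleton, rowLen_ofParts_pair]
  refine ⟨_, _, h3 _ c1, h3 _ c2, ?_⟩
  rw [DifferByOneBox, ← h1, h2, h2, h2]
  omega

theorem two_le_of_two_le_dp {lam : YoungDiagram} (h : 2 ≤ dp lam) :
    2 ≤ lam.colLen 0 ∧ lam.rowLen (lam.colLen 0 - 1) < lam.rowLen 0 := by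
  have h1 : 2 ≤ lam.colLen 0 := by
    rw [← length_rowLens]
    exact h.trans (List.toFinset_card_le _)
  refine ⟨h1, ?_⟩
  by_contra hc
  have h2 : lam.rowLens.toFinset ⊆ {lam.rowLen 0} := by
    intro v hv
    obtain ⟨i, hi, rfl⟩ := List.mem_map.1 (List.mem_toFinset.1 hv)
    have h3 := lam.rowLen_anti 0 i (Nat.zero_le i)
    have h4 := lam.rowLen_anti i (lam.colLen 0 - 1) (by have := List.mem_range.1 hi; omega)
    exact Finset.mem_singleton.2 (by omega)
  have h3 := Finset.card_le_card h2
  rw [Finset.card_singleton] at h3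
  exact absurd (h.trans h3) (by omega)

theorem union_ofParts_ends {lam : YoungDiagram} (h : 2 ≤ lam.colLen 0) :
    union (ofParts [lam.rowLen 0, lam.rowLen (lam.colLen 0 - 1)])
      (ofParts lam.rowLens.tail.dropLast) = lam := by
  obtain ⟨k, hk⟩ : ∃ k, lam.colLen 0 = k + 2 := ⟨lam.colLen 0 - 2, by omega⟩
  have hw : lam.rowLens =
      lam.rowLen 0 :: (lam.rowLens.tail.dropLast ++ [lam.rowLen (lam.colLen 0 - 1)]) := by
    have h1 : lam.rowLens = lam.rowLen 0 ::
        ((List.range k).map (fun i => lam.rowLen (i + 1)) ++ [lam.rowLen (k + 1)]) := by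
      rw [rowLens, hk, List.range_succ_eq_map, List.range_succ]
      simp [Function.comp_def]
    rw [h1, List.tail_cons, List.dropLast_concat, hk]
    rfl
  apply ext_colLen
  intro j
  have h1 := congrArg (List.countP (j < ·)) hw
  rw [colLen_union, colLen_ofParts, colLen_ofParts, colLen_eq_countP lam j, h1]
  simp only [List.countP_cons, List.countP_append, List.countP_nil]
  omega

theorem union_ofParts_head {mu : YoungDiagram} :
    union (ofParts [mu.rowLen 0]) (ofParts mu.rowLens.tail) = mu := by
  apply ext_colLen
  intro j
  rw [colLen_union, colLen_ofParts, colLen_ofParts, colLen_eq_countP mu]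
  cases hk : mu.colLen 0 with
  | zero =>
    have h1 : mu.rowLens = [] := by rw [rowLens, hk]; rfl
    rw [h1, (rowLen_eq_zero_iff mu 0).2 hk.le]
    simp
  | succ k =>
    have h1 : mu.rowLens = mu.rowLen 0 :: (List.range k).map fun i => mu.rowLen (i + 1) := by
      rw [rowLens, hk, List.range_succ_eq_map]
      simp [Function.comp_def]
    rw [h1, List.tail_cons, List.countP_cons, List.countP_cons, List.countP_nil]
    omega

theorem IsBasic.tail_le {lam mu : YoungDiagram} (h : IsBasic lam mu) (h2 : 2 ≤ lam.colLen 0) :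
    ofParts mu.rowLens.tail ≤ ofParts lam.rowLens.tail.dropLast := by
  rw [le_iff_colLen_le]
  intro j
  have h1 := congrArg (fun a => a.colLen j) (union_ofParts_ends h2)
  have h3 := congrArg (fun a => a.colLen j) (union_ofParts_head (mu := mu))
  simp only [colLen_union, colLen_ofParts [_], colLen_ofParts [_, _], List.countP_cons,
    List.countP_nil, decide_eq_true_eq] at h1 h3
  have h4 := lt_rowLen_iff_lt_colLen mu 0 j
  rcases Nat.eq_zero_or_pos (mu.colLen j) with h0 | h0
  · omega
  · obtain ⟨c, hc⟩ : ∃ c, mu.colLen j = c + 1 := ⟨mu.colLen j - 1, by omega⟩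
    have h5 := le_iff_colLen_le.1 h.1 j
    have h6 := lam.colLen_anti 0 j (Nat.zero_le j)
    -- As the diagram is basic, column `j` of `lam` is longer than a nonempty column `j` of `mu`.
    -- This pays for removing two parts from `lam` and only one from `mu`.
    have h7 := (h.2 c (by omega)).2
    have h8 := (lt_rowLen_iff_lt_colLen mu c j).2 (by omega)
    have h9 := (lt_rowLen_iff_lt_colLen lam (c + 1) j).1 (by omega)
    split_ifs at h1 h3 <;> omega

/-- The first and last parts of `lam` and the first part of `mu` form the sum of `A` and `(2, 1) /
(1)`; the remaining parts form `B`. From `2 ≤ delta lam mu` come two different parts of `lam` and a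
positive part of `mu`, so none of the subtractions is truncated and the parts of `A` stay in order.
-/
theorem IsBasic.max_encard_le {lam mu : YoungDiagram} (h : IsBasic lam mu)
    (hd : 2 ≤ delta lam mu) :
    max
      (components (ofParts [lam.rowLen 0 - 2, lam.rowLen (lam.colLen 0 - 1) - 1])
        (ofParts [mu.rowLen 0 - 1])).encard
      (components (ofParts lam.rowLens.tail.dropLast) (ofParts mu.rowLens.tail)).encard
      ≤ (componentPairs lam mu).encard := by
  obtain ⟨h1, h2⟩ := two_le_of_two_le_dp (hd.trans (min_le_right _ _))
  have hmu : 0 < mu.rowLen 0 := by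
    by_contra hc
    have h3 : mu.rowLens = [] := by
      rw [← List.length_eq_zero_iff, length_rowLens]
      exact Nat.le_zero.1 ((rowLen_eq_zero_iff mu 0).1 (by omega))
    have h4 := hd.trans (min_le_left _ _)
    rw [dp, h3] at h4
    exact absurd h4 (by decide)
  have hlast : 0 < lam.rowLen (lam.colLen 0 - 1) :=
    (lt_rowLen_iff_lt_colLen _ _ _).2 (by omega)
  have hlt := (h.2 0 (by omega)).1
  obtain ⟨d, e, hd, he, hde⟩ := exists_components_two_one
  have hA : ofParts [mu.rowLen 0 - 1] ≤
      ofParts [lam.rowLen 0 - 2, lam.rowLen (lam.colLen 0 - 1) - 1] := by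
    rw [le_iff_rowLen_le]
    intro i
    rw [rowLen_ofParts_singleton, rowLen_ofParts_pair (by omega)]
    split_ifs <;> omega
  have key := max_encard_le_encard_componentPairs hA (h.tail_le h1) hd he hde
  have e1 : add (ofParts [lam.rowLen 0 - 2, lam.rowLen (lam.colLen 0 - 1) - 1]) (ofParts [2, 1]) =
      ofParts [lam.rowLen 0, lam.rowLen (lam.colLen 0 - 1)] := by
    apply ext_rowLen
    intro i
    rw [rowLen_add, rowLen_ofParts_pair (by omega), rowLen_ofParts_pair (by omega),
      rowLen_ofParts_pair (by omega)]
    split_ifs <;> omega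
  have e2 : add (ofParts [mu.rowLen 0 - 1]) (ofParts [1]) = ofParts [mu.rowLen 0] := by
    apply ext_rowLen
    intro i
    rw [rowLen_add, rowLen_ofParts_singleton, rowLen_ofParts_singleton, rowLen_ofParts_singleton]
    split_ifs <;> omega
  rwa [e1, e2, union_ofParts_ends h1, union_ofParts_head] at key

end SkewChar

theorem theorem3p9 (lam mu : YoungDiagram) (n : ℕ) (hbasic : SkewChar.IsBasic lam mu)
    (hdelta : SkewChar.delta lam mu = n) (hn : 2 ≤ n) :
    SkewChar.g n ≤ (SkewChar.componentPairs lam mu).encard ∧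
    max
      (SkewChar.components
        (SkewChar.ofParts [lam.rowLen 0 - 2, lam.rowLen (lam.colLen 0 - 1) - 1])
        (SkewChar.ofParts [mu.rowLen 0 - 1])).encard
      (SkewChar.components
        (SkewChar.ofParts lam.rowLens.tail.dropLast)
        (SkewChar.ofParts mu.rowLens.tail)).encard
      ≤ (SkewChar.componentPairs lam mu).encard := by
  subst hdelta
  exact ⟨hbasic.rich.g_le, hbasic.max_encard_le hn⟩
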